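/- **Theorem (Douglas model for And\^o lifts).** All Hilbert spaces are complex. Let $(T_1,T_2)$ be a commuting pair of contractions on a Hilbert space $\mathcal H$ and put $T=T_1T_2$. *Notation.* $D_{T^*}=(I-TT^*)^{1/2}$, $\mathcal D_{T^*}=\overline{\operatorname{Ran}}\,D_{T^*}$, and $Q_{T^*}$ is the positive square root of the strong limit of $T^nT^{*n}$. The map $Q_{T^*}h\mapsto Q_{T^*}T^*h$ extends to an isometry $X^*$ on $\overline{\operatorname{Ran}}\,Q_{T^*}$; its minimal unitary extension is denoted $W_D^*$ and acts on $\mathcal Q_{T^*}\supseteq\overline{\operatorname{Ran}}\,Q_{T^*}$. For a Hilbert space $\mathcal F$, $H^2(\mathcal F)$ is the Hardy space of functions $f(z)=\sum_{n\ge0} z^nf_n$ on the unit disc with values in $\mathcal F$ and $\|f\|^2=\sum\|f_n\|^2<\infty$, and $M_\varphi$ is multiplication by $\varphi$. The operator $\mathcal O_{D_{T^*},T^*}\colon\mathcal H\to H^2(\mathcal D_{T^*})$ is $h\mapsto\sum_{n\ge0}z^nD_{T^*}T^{*n}h$. An *And\^o lift* of $(T_1,T_2)$ is a triple $(\Pi,V_1,V_2)$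 where $\Pi\colon\mathcal H\to\mathcal K$ is an isometric embedding into a Hilbert space and $V_1,V_2$ are commuting isometries on $\mathcal K$ with $V_j^*\Pi=\Pi T_j^*$ for $j=1,2$. It is *minimal* if $\mathcal K$ is the closed linear span of the spaces $V_1^{m}V_2^{n}\operatorname{Ran}\Pi$, $m,n\ge0$. Two lifts $(\Pi,V_1,V_2)$, $(\Pi',V_1',V_2')$ on $\mathcal K,\mathcal K'$ are *unitarily equivalent* if there is a unitary $\tau\colon\mathcal K\to\mathcal K'$ with $\tau\Pi=\Pi'$ and $\tau V_j=V_j'\tau$ for $j=1,2$. A *Type I And\^o tuple* for $(T_1^*,T_2^*)$ is $(\mathcal F_*,\Lambda_*,P_*,U_*)$ where $\mathcal F_*$ is a Hilbert space, $\Lambda_*\colon\mathcal D_{T^*}\to\mathcal F_*$ is an isometry, $P_*$ is an orthogonal projection and $U_*$ a unitary operator on $\mathcal F_*$ such that, with $P_*^\perp=I-P_*$, $$P_*^\perp U_*\Lambda_*D_{T^*}+P_*U_*\Lambda_*D_{T^*}T^*=\Lambda_*D_{T^*}T_1^*,\qquad U_*^*P_*\Lambda_*D_{T^*}+U_*^*P_*^\perp\Lambda_*D_{T^*}T^*=\Lambda_*D_{T^*}T_2^*.$$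 It is *Douglas-minimal* if the smallest closed subspace of $H^2(\mathcal F_*)$ that contains $H^2(\operatorname{Ran}\Lambda_*)$ and is invariant under $M_{U_*^*(P_*^\perp+zP_*)}$ and $M_{(P_*+zP_*^\perp)U_*}$ is $H^2(\mathcal F_*)$. *Statement.* There is exactly one pair $(W_{\flat1},W_{\flat2})$ of commuting unitary operators on $\mathcal Q_{T^*}$ with $W_{\flat1}W_{\flat2}=W_D$ and $W_{\flat j}^*Q_{T^*}=Q_{T^*}T_j^*$ for $j=1,2$, and for this pair the following hold. 1. For every Douglas-minimal Type I And\^o tuple $(\mathcal F_*,\Lambda_*,P_*,U_*)$ for $(T_1^*,T_2^*)$, the triple $$\Pi_D=\begin{bmatrix}(I_{H^2}\otimes\Lambda_*)\mathcal O_{D_{T^*},T^*}\\ Q_{T^*}\end{bmatrix},\quad V_{D,1}=\begin{bmatrix}M_{U_*^*(P_*^\perp+zP_*)}&0\\0&W_{\flat1}\end{bmatrix},\quad V_{D,2}=\begin{bmatrix}M_{(P_*+zP_*^\perp)U_*}&0\\0&W_{\flat2}\end{bmatrix}$$ on $H^2(\mathcal F_*)\oplus\mathcal Q_{T^*}$ is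 a minimal And\^o lift of $(T_1,T_2)$. 2. Conversely, for every minimal And\^o lift $(\Pi,V_1,V_2)$ of $(T_1,T_2)$ there is a Douglas-minimal Type I And\^o tuple for $(T_1^*,T_2^*)$ such that $(\Pi,V_1,V_2)$ is unitarily equivalent to the lift $(\Pi_D,V_{D,1},V_{D,2})$ built from that tuple as in 1. -/

import Mathlib

open ContinuousLinearMap Filter Topology
open scoped ENNReal

noncomputable section

namespace AndoModel

/-! ### The vector-valued Hardy space of the unit disc -/

section Hardy

variable {E F : Type*} [NormedAddCommGroup E] [InnerProductSpace ℂ E]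
  [NormedAddCommGroup F] [InnerProductSpace ℂ F]

/-- The open unit disc. -/
abbrev Disc : Type := Metric.ball (0 : ℂ) 1

/-- Square summable sequences of vectors. -/
abbrev SqSeq (F : Type*) [NormedAddCommGroup F] : Type _ := lp (fun _ : ℕ => F) 2

theorem summable_powerSeries [CompleteSpace F] (a : SqSeq F) (z : Disc) :
    Summable fun n => (z : ℂ) ^ n • a n := by
  have hz : ‖(z : ℂ)‖ < 1 := mem_ball_zero_iff.mp z.2
  refine Summable.of_norm_bounded (g := fun n => ‖(z : ℂ)‖ ^ n * ‖a‖)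
    ((summable_geometric_of_lt_one (norm_nonneg _) hz).mul_right _) fun n => ?_
  rw [norm_smul, norm_pow]
  gcongr
  exact lp.norm_apply_le_norm two_ne_zero a n

/-- The function `z ↦ ∑ zⁿ aₙ` on the disc attached to a square summable sequence `a`. -/
def powerSeries (F : Type*) [NormedAddCommGroup F] [InnerProductSpace ℂ F] [CompleteSpace F] :
    SqSeq F →ₗ[ℂ] (Disc → F) where
  toFun a z := ∑' n, (z : ℂ) ^ n • a n
  map_add' a b := by
    funext z
    simp only [lp.coeFn_add, Pi.add_apply, smul_add]
    exact (summable_powerSeries a z).tsum_add (summable_powerSeries b z)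
  map_smul' c a := by
    funext z
    simp only [lp.coeFn_smul, Pi.smul_apply, RingHom.id_apply]
    rw [← (summable_powerSeries a z).tsum_const_smul c]
    exact tsum_congr fun n => smul_comm _ _ _

theorem powerSeries_injective [CompleteSpace F] : Function.Injective (powerSeries F) := by
  rw [injective_iff_map_eq_zero]
  intro a ha
  let p : FormalMultilinearSeries ℂ ℂ F :=
    fun n => ContinuousMultilinearMap.mkPiRing ℂ (Fin n) (a n)
  have hp : HasFPowerSeriesAt (fun _ : ℂ => (0 : F)) p 0 := by
    rw [hasFPowerSeriesAt_iff]
    filter_upwards [Metric.ball_mem_nhds (0 : ℂ) one_pos] with z hz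
    have h := (summable_powerSeries a ⟨z, hz⟩).hasSum
    have h0 : ∑' n, z ^ n • a n = 0 := congrFun ha ⟨z, hz⟩
    rw [h0] at h
    simpa [p, FormalMultilinearSeries.coeff] using h
  ext n
  have h1 := congrArg (fun q : FormalMultilinearSeries ℂ ℂ F => q.coeff n) hp.eq_zero
  simpa [p, FormalMultilinearSeries.coeff] using h1

/-- The sequence `(0, a₀, a₁, …)`. -/
def delay {F : Type*} [NormedAddCommGroup F] (a : ℕ → F) : ℕ → F
  | 0 => 0
  | n + 1 => a n

theorem summable_delay {F : Type*} [NormedAddCommGroup F] (a : SqSeq F) :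
    Summable fun n => ‖delay (a : ℕ → F) n‖ ^ (2 : ℝ≥0∞).toReal := by
  rw [← summable_nat_add_iff 1]
  exact (lp.memℓp a).summable (by norm_num)

/-- The right shift `(a₀, a₁, …) ↦ (0, a₀, a₁, …)` on square summable sequences. -/
def seqShift (F : Type*) [NormedAddCommGroup F] [InnerProductSpace ℂ F] :
    SqSeq F →L[ℂ] SqSeq F :=
  LinearMap.mkContinuous
    { toFun := fun a => ⟨delay (a : ℕ → F), memℓp_gen (summable_delay a)⟩
      map_add' := fun a b => by
        ext n
        cases n with
        | zero => exact (add_zero (0 : F)).symm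
        | succ n => rfl
      map_smul' := fun c a => by
        ext n
        cases n with
        | zero => exact (smul_zero c).symm
        | succ n => rfl }
    1 fun a => by
      refine lp.norm_le_of_tsum_le (by norm_num) (by positivity) ?_
      rw [one_mul, lp.norm_rpow_eq_tsum (by norm_num) a]
      refine le_of_eq ?_
      have h := (summable_delay a).tsum_eq_zero_add
      simpa [delay] using h

theorem seqShift_zero (a : SqSeq F) : seqShift F a 0 = 0 := rfl

theorem seqShift_succ (a : SqSeq F) (n : ℕ) : seqShift F a (n + 1) = a n := rfl

/-- A bounded operator applied to each term of a square summable sequence. -/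
def seqMap (A : E →L[ℂ] F) : SqSeq E →L[ℂ] SqSeq F :=
  lp.mapCLM 2 (fun _ : ℕ => A) (norm_nonneg A) fun _ => le_rfl

theorem seqMap_apply (A : E →L[ℂ] F) (a : SqSeq E) (n : ℕ) : seqMap A a n = A (a n) := rfl

/-- The Hardy space `H²(F)`: the functions `f(z) = ∑ zⁿ fₙ` on the unit disc
with `∑ ‖fₙ‖² < ∞`. -/
def Hardy (F : Type*) [NormedAddCommGroup F] [InnerProductSpace ℂ F] [CompleteSpace F] : Type _ :=
  LinearMap.range (powerSeries F)

variable [CompleteSpace E] [CompleteSpace F]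

namespace Hardy

instance : AddCommGroup (Hardy F) :=
  inferInstanceAs (AddCommGroup (LinearMap.range (powerSeries F)))

instance : Module ℂ (Hardy F) :=
  inferInstanceAs (Module ℂ (LinearMap.range (powerSeries F)))

instance : CoeFun (Hardy F) fun _ => Disc → F := ⟨fun f => f.1⟩

/-- The linear bijection between square summable sequences and Hardy functions. -/
def ofSeqLin (F : Type*) [NormedAddCommGroup F] [InnerProductSpace ℂ F] [CompleteSpace F] :
    SqSeq F ≃ₗ[ℂ] Hardy F :=
  LinearEquiv.ofInjective (powerSeries F) powerSeries_injective

/-- The norm of `f` is the square root of `∑ ‖fₙ‖²`. -/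
instance : NormedAddCommGroup (Hardy F) :=
  NormedAddCommGroup.induced (Hardy F) (SqSeq F) (ofSeqLin F).symm (ofSeqLin F).symm.injective

/-- The inner product of `f` and `g` is `∑ ⟪fₙ, gₙ⟫`. -/
instance : InnerProductSpace ℂ (Hardy F) where
  norm_smul_le c f := by
    change ‖(ofSeqLin F).symm (c • f)‖ ≤ ‖c‖ * ‖(ofSeqLin F).symm f‖
    rw [map_smul, norm_smul]
  inner f g := inner ℂ ((ofSeqLin F).symm f) ((ofSeqLin F).symm g)
  norm_sq_eq_re_inner f := norm_sq_eq_re_inner (𝕜 := ℂ) ((ofSeqLin F).symm f)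
  conj_inner_symm f g := inner_conj_symm _ _
  add_left f g h := by
    change inner ℂ ((ofSeqLin F).symm (f + g)) ((ofSeqLin F).symm h) = _
    rw [map_add, inner_add_left]
  smul_left f g c := by
    change inner ℂ ((ofSeqLin F).symm (c • f)) ((ofSeqLin F).symm g) = _
    rw [map_smul, inner_smul_left]

/-- The unitary map sending `(fₙ)` to the function `f(z) = ∑ zⁿ fₙ`. -/
def ofSeq (F : Type*) [NormedAddCommGroup F] [InnerProductSpace ℂ F] [CompleteSpace F] :
    SqSeq F ≃ₗᵢ[ℂ] Hardy F where
  toLinearEquiv := ofSeqLin F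
  norm_map' a := by
    change ‖(ofSeqLin F).symm (ofSeqLin F a)‖ = ‖a‖
    rw [LinearEquiv.symm_apply_apply]

instance : CompleteSpace (Hardy F) :=
  (ofSeq F).toIsometryEquiv.completeSpace_iff.mp inferInstance

theorem ofSeq_apply (a : SqSeq F) (z : Disc) : ofSeq F a z = ∑' n, (z : ℂ) ^ n • a n := rfl

theorem hasSum_ofSeq (a : SqSeq F) (z : Disc) :
    HasSum (fun n => (z : ℂ) ^ n • a n) (ofSeq F a z) :=
  (summable_powerSeries a z).hasSum

@[ext] theorem ext {f g : Hardy F} (h : ∀ z, f z = g z) : f = g := Subtype.ext (funext h)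

/-- Multiplication by the operator-valued function `z ↦ A + z B`. -/
def mul (A B : E →L[ℂ] F) : Hardy E →L[ℂ] Hardy F :=
  (ofSeq F).toContinuousLinearEquiv.toContinuousLinearMap ∘L
    (seqMap A + seqShift F ∘L seqMap B) ∘L
      (ofSeq E).symm.toContinuousLinearEquiv.toContinuousLinearMap

theorem mul_apply (A B : E →L[ℂ] F) (f : Hardy E) (z : Disc) :
    mul A B f z = A (f z) + (z : ℂ) • B (f z) := by
  obtain ⟨a, rfl⟩ := (ofSeq E).surjective f
  have h1 : mul A B (ofSeq E a) = ofSeq F (seqMap A a) + ofSeq F (seqShift F (seqMap B a)) := by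
    simp [mul]
  have hA : ofSeq F (seqMap A a) z = A (ofSeq E a z) := by
    refine (hasSum_ofSeq (seqMap A a) z).unique ?_
    simpa [seqMap_apply] using A.hasSum (hasSum_ofSeq a z)
  have hB : ofSeq F (seqShift F (seqMap B a)) z = (z : ℂ) • B (ofSeq E a z) := by
    refine (hasSum_ofSeq _ z).unique ?_
    rw [← hasSum_nat_add_iff' 1]
    have h := (B.hasSum (hasSum_ofSeq a z)).const_smul (z : ℂ)
    simpa [seqShift_zero, seqShift_succ, seqMap_apply, pow_succ', mul_smul] using h
  rw [h1, ← hA, ← hB]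
  rfl

/-- Multiplication by the coordinate function. -/
def shift (F : Type*) [NormedAddCommGroup F] [InnerProductSpace ℂ F] [CompleteSpace F] :
    Hardy F →L[ℂ] Hardy F := mul 0 (ContinuousLinearMap.id ℂ F)

/-- `I ⊗ A`: the operator `A` applied to each value of a Hardy function. -/
def map (A : E →L[ℂ] F) : Hardy E →L[ℂ] Hardy F := mul A 0

theorem shift_apply (f : Hardy F) (z : Disc) : shift F f z = (z : ℂ) • f z := by
  simp [shift, mul_apply]

theorem map_apply (A : E →L[ℂ] F) (f : Hardy E) (z : Disc) : map A f z = A (f z) := by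
  simp [map, mul_apply]

/-- The constant function with a given value. -/
def const (F : Type*) [NormedAddCommGroup F] [InnerProductSpace ℂ F] [CompleteSpace F] :
    F →L[ℂ] Hardy F :=
  (ofSeq F).toContinuousLinearEquiv.toContinuousLinearMap ∘L
    lp.singleContinuousLinearMap ℂ (fun _ : ℕ => F) 2 0

theorem const_apply (x : F) (z : Disc) : const F x z = x := by
  refine (hasSum_ofSeq (lp.single 2 0 x : SqSeq F) z).unique ?_
  have h := hasSum_single (f := fun n : ℕ => (z : ℂ) ^ n • (lp.single 2 0 x : SqSeq F) n) 0
    fun n hn => by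
      rw [lp.single_apply_ne (E := fun _ : ℕ => F) 2 0 x hn, smul_zero]
  simpa using h

end Hardy

end Hardy

/-! ### Defect operators, the observability operator and the asymptotic limit -/

section Contraction

variable {H : Type*} [NormedAddCommGroup H] [InnerProductSpace ℂ H] [CompleteSpace H]

/-- The defect operator `D_T = (I - T*T)^{1/2}`. -/
def defectOp (T : H →L[ℂ] H) : H →L[ℂ] H := CFC.sqrt (1 - adjoint T * T)

/-- The defect space `𝒟_T`, the closure of the range of `D_T`. -/
def DefectSpace (T : H →L[ℂ] H) : Submodule ℂ H :=
  (LinearMap.range (defectOp T).toLinearMap).topologicalClosure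

instance (T : H →L[ℂ] H) : CompleteSpace (DefectSpace T) :=
  inferInstanceAs (CompleteSpace (LinearMap.range (defectOp T).toLinearMap).topologicalClosure)

/-- `D_T` as an operator from `H` to the defect space. -/
def defectMap (T : H →L[ℂ] H) : H →L[ℂ] DefectSpace T :=
  (defectOp T).codRestrict (DefectSpace T) fun h =>
    Submodule.le_topologicalClosure _ ⟨h, rfl⟩

theorem norm_defectMap_sq {T : H →L[ℂ] H} (hT : ‖T‖ ≤ 1) (h : H) :
    ‖defectMap T h‖ ^ 2 = ‖h‖ ^ 2 - ‖T h‖ ^ 2 := by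
  have hpos : (0 : H →L[ℂ] H) ≤ 1 - adjoint T * T := by
    rw [sub_nonneg]
    have h1 : ‖adjoint T * T‖ ≤ 1 := by
      have := norm_mul_le (adjoint T) T
      rw [LinearIsometryEquiv.norm_map] at this
      nlinarith [norm_nonneg T]
    exact (CStarAlgebra.norm_le_one_iff_of_nonneg _ (star_mul_self_nonneg T)).mp h1
  have hsq : defectOp T * defectOp T = 1 - adjoint T * T := CFC.sqrt_mul_sqrt_self _ hpos
  have hsa : adjoint (defectOp T) = defectOp T :=
    (IsSelfAdjoint.of_nonneg (CFC.sqrt_nonneg (1 - adjoint T * T))).adjoint_eq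
  have e1 : ‖defectMap T h‖ ^ 2 = RCLike.re (inner ℂ (defectOp T h) (defectOp T h)) := by
    rw [← norm_sq_eq_re_inner]; rfl
  have e2 : inner ℂ (defectOp T h) (defectOp T h) = inner ℂ ((defectOp T * defectOp T) h) h := by
    conv_lhs => rw [← adjoint_inner_left, hsa]
    rfl
  rw [e1, e2, hsq]
  simp only [_root_.sub_apply, mul_apply_eq_comp, inner_sub_left,
    adjoint_inner_left, map_sub, one_apply_eq_self]
  rw [← norm_sq_eq_re_inner, ← norm_sq_eq_re_inner]

theorem norm_adjoint_le {T : H →L[ℂ] H} (hT : ‖T‖ ≤ 1) : ‖adjoint T‖ ≤ 1 := by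
  rwa [LinearIsometryEquiv.norm_map]

theorem sum_norm_defectMap_sq {T : H →L[ℂ] H} (hT : ‖T‖ ≤ 1) (h : H) (N : ℕ) :
    ∑ n ∈ Finset.range N, ‖defectMap T ((T ^ n) h)‖ ^ 2 = ‖h‖ ^ 2 - ‖(T ^ N) h‖ ^ 2 := by
  induction N with
  | zero => simp
  | succ N ih =>
    rw [Finset.sum_range_succ, ih, norm_defectMap_sq hT, pow_succ' T N, mul_apply_eq_comp]
    ring

theorem sum_norm_defectMap_sq_le {T : H →L[ℂ] H} (hT : ‖T‖ ≤ 1) (h : H) (s : Finset ℕ) :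
    ∑ n ∈ s, ‖defectMap T ((T ^ n) h)‖ ^ (2 : ℝ≥0∞).toReal ≤ ‖h‖ ^ (2 : ℝ≥0∞).toReal := by
  simp only [ENNReal.toReal_ofNat, Real.rpow_two]
  obtain ⟨N, hN⟩ := s.exists_nat_subset_range
  calc _ ≤ ∑ n ∈ Finset.range N, ‖defectMap T ((T ^ n) h)‖ ^ 2 :=
        Finset.sum_le_sum_of_subset_of_nonneg hN fun _ _ _ => by positivity
    _ ≤ ‖h‖ ^ 2 := by rw [sum_norm_defectMap_sq hT]; nlinarith [sq_nonneg ‖(T ^ N) h‖]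

/-- For a contraction `S`, the map `h ↦ (D_S Sⁿ h)ₙ`. -/
def obsSeq (S : H →L[ℂ] H) (hS : ‖S‖ ≤ 1) : H →L[ℂ] SqSeq (DefectSpace S) :=
  LinearMap.mkContinuous
    { toFun := fun h => (⟨fun n => defectMap S ((S ^ n) h),
        memℓp_gen' (sum_norm_defectMap_sq_le hS h)⟩ : SqSeq (DefectSpace S))
      map_add' := fun a b => lp.ext (funext fun n => by
        change defectMap S ((S ^ n) (a + b)) = defectMap S ((S ^ n) a) + defectMap S ((S ^ n) b)
        rw [map_add, map_add])
      map_smul' := fun c a => lp.ext (funext fun n => by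
        change defectMap S ((S ^ n) (c • a)) = c • defectMap S ((S ^ n) a)
        rw [map_smul, map_smul]) }
    1 fun h => lp.norm_le_of_forall_sum_le (by norm_num) (by positivity) (by
      rw [one_mul]
      exact sum_norm_defectMap_sq_le hS h)

/-- For a contraction `S`, the observability operator `𝒪_{D_S, S} : H → H²(𝒟_S)`,
which sends `h` to the function `z ↦ ∑ zⁿ D_S Sⁿ h`. -/
def obsOp (S : H →L[ℂ] H) (hS : ‖S‖ ≤ 1) : H →L[ℂ] Hardy (DefectSpace S) :=
  (Hardy.ofSeq (DefectSpace S)).toContinuousLinearEquiv.toContinuousLinearMap ∘L obsSeq S hS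

theorem hasSum_obsOp (S : H →L[ℂ] H) (hS : ‖S‖ ≤ 1) (h : H) (z : Disc) :
    HasSum (fun n => (z : ℂ) ^ n • defectMap S ((S ^ n) h)) (obsOp S hS h z) :=
  Hardy.hasSum_ofSeq (obsSeq S hS h) z

theorem norm_apply_sq_le_re_inner {B : H →L[ℂ] H} (h0 : 0 ≤ B) (h1 : B ≤ 1) (x : H) :
    ‖B x‖ ^ 2 ≤ RCLike.re (inner ℂ (B x) x) := by
  set S := CFC.sqrt B with hS
  have hSS : S * S = B := CFC.sqrt_mul_sqrt_self B h0
  have hsa : adjoint S = S := (IsSelfAdjoint.of_nonneg (CFC.sqrt_nonneg B)).adjoint_eq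
  have hB : ‖B‖ ≤ 1 := (CStarAlgebra.norm_le_one_iff_of_nonneg B h0).mpr h1
  have hS1 : ‖S‖ ≤ 1 := by
    have h2 : ‖adjoint S * S‖ = ‖S‖ * ‖S‖ := CStarRing.norm_star_mul_self (x := S)
    rw [hsa, hSS] at h2
    nlinarith [norm_nonneg S]
  have e : inner ℂ (B x) x = inner ℂ (S x) (S x) := by
    rw [← hSS, mul_apply_eq_comp]
    nth_rewrite 1 [← hsa]
    rw [adjoint_inner_left]
  rw [e, ← norm_sq_eq_re_inner, ← hSS, mul_apply_eq_comp]
  have h3 : ‖S (S x)‖ ≤ ‖S x‖ := by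
    calc _ ≤ ‖S‖ * ‖S x‖ := S.le_opNorm _
      _ ≤ 1 * ‖S x‖ := by gcongr
      _ = _ := one_mul _
  gcongr

theorem re_inner_pow_mul_adjoint_pow (T : H →L[ℂ] H) (n : ℕ) (x : H) :
    RCLike.re (inner ℂ ((T ^ n * adjoint T ^ n) x) x) = ‖(adjoint T ^ n) x‖ ^ 2 := by
  have h : adjoint (adjoint T ^ n) = T ^ n := by
    have := star_pow (star T) n
    rwa [star_star] at this
  rw [mul_apply_eq_comp, ← h, adjoint_inner_left, ← norm_sq_eq_re_inner]

theorem antitone_pow_mul_adjoint_pow {T : H →L[ℂ] H} (hT : ‖T‖ ≤ 1) :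
    Antitone fun n => T ^ n * adjoint T ^ n := by
  refine antitone_nat_of_succ_le fun n => ?_
  have h1 : T * adjoint T ≤ 1 := by
    refine (CStarAlgebra.norm_le_one_iff_of_nonneg _ (mul_star_self_nonneg T)).mp ?_
    have h2 := norm_mul_le T (adjoint T)
    have h3 := mul_le_one₀ hT (norm_nonneg (adjoint T)) (norm_adjoint_le hT)
    exact h2.trans h3
  have h2 := star_right_conjugate_le_conjugate h1 (T ^ n)
  have h3 : star (T ^ n) = adjoint T ^ n := star_pow T n
  rw [h3, mul_one] at h2
  calc _ = T ^ n * (T * adjoint T) * adjoint T ^ n := by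
        rw [pow_succ T, pow_succ' (adjoint T)]; simp only [mul_assoc]
    _ ≤ _ := h2

theorem exists_limit_pow_mul_adjoint_pow {T : H →L[ℂ] H} (hT : ‖T‖ ≤ 1) (x : H) :
    ∃ y, Tendsto (fun n => (T ^ n * adjoint T ^ n) x) atTop (𝓝 y) := by
  let c : ℕ → ℝ := fun n => RCLike.re (inner ℂ ((T ^ n * adjoint T ^ n) x) x)
  have key : ∀ m n, m ≤ n →
      ‖(T ^ m * adjoint T ^ m) x - (T ^ n * adjoint T ^ n) x‖ ^ 2 ≤ c m - c n := by
    intro m n hmn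
    have hle := antitone_pow_mul_adjoint_pow hT hmn
    have hm : T ^ m * adjoint T ^ m ≤ 1 := by
      simpa using antitone_pow_mul_adjoint_pow hT (Nat.zero_le m)
    have hn : 0 ≤ T ^ n * adjoint T ^ n := by
      have h3 : star (T ^ n) = adjoint T ^ n := star_pow T n
      rw [← h3]; exact mul_star_self_nonneg _
    have := norm_apply_sq_le_re_inner (sub_nonneg.mpr hle) ((sub_le_self _ hn).trans hm) x
    simpa [c, inner_sub_left] using this
  have hanti : Antitone c := fun m n hmn => by
    have := key m n hmn
    nlinarith [sq_nonneg ‖(T ^ m * adjoint T ^ m) x - (T ^ n * adjoint T ^ n) x‖]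
  have hbdd : BddBelow (Set.range c) := ⟨0, by
    rintro _ ⟨n, rfl⟩
    simp only [c, re_inner_pow_mul_adjoint_pow]
    positivity⟩
  have hc := tendsto_atTop_ciInf hanti hbdd
  set l := ⨅ n, c n with hl
  refine cauchySeq_tendsto_of_complete ?_
  refine cauchySeq_of_le_tendsto_0' (fun n => Real.sqrt (c n - l)) (fun m n hmn => ?_) ?_
  · rw [dist_eq_norm]
    refine Real.le_sqrt_of_sq_le ((key m n hmn).trans ?_)
    have := ciInf_le hbdd n
    linarith
  · have := (hc.sub_const l).sqrt
    simpa using this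

/-- For a contraction `T`, the strong limit of `Tⁿ T*ⁿ`. -/
def asymptoticLimit (T : H →L[ℂ] H) (hT : ‖T‖ ≤ 1) : H →L[ℂ] H :=
  continuousLinearMapOfTendsto (fun n => T ^ n * adjoint T ^ n)
    (tendsto_pi_nhds.mpr fun x => (exists_limit_pow_mul_adjoint_pow hT x).choose_spec)

theorem tendsto_asymptoticLimit (T : H →L[ℂ] H) (hT : ‖T‖ ≤ 1) (x : H) :
    Tendsto (fun n => (T ^ n * adjoint T ^ n) x) atTop (𝓝 (asymptoticLimit T hT x)) :=
  (exists_limit_pow_mul_adjoint_pow hT x).choose_spec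

/-- The operator `Q_{T*}`, the positive square root of the strong limit of `Tⁿ T*ⁿ`. -/
def Qop (T : H →L[ℂ] H) (hT : ‖T‖ ≤ 1) : H →L[ℂ] H := CFC.sqrt (asymptoticLimit T hT)

open scoped ComplexOrder in
theorem asymptoticLimit_nonneg (T : H →L[ℂ] H) (hT : ‖T‖ ≤ 1) : 0 ≤ asymptoticLimit T hT := by
  have hpos (n : ℕ) : (T ^ n * adjoint T ^ n).IsPositive := by
    rw [← nonneg_iff_isPositive]
    have h3 : star (T ^ n) = adjoint T ^ n := star_pow T n
    rw [← h3]; exact mul_star_self_nonneg _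
  rw [nonneg_iff_isPositive, isPositive_iff_complex]
  intro x
  have h1 : Tendsto (fun n => inner ℂ ((T ^ n * adjoint T ^ n) x) x) atTop
      (𝓝 (inner ℂ (asymptoticLimit T hT x) x)) :=
    (tendsto_asymptoticLimit T hT x).inner tendsto_const_nhds
  have h2 : ∀ n, (0 : ℂ) ≤ inner ℂ ((T ^ n * adjoint T ^ n) x) x := fun n =>
    (hpos n).inner_nonneg_left x
  have h3 : (0 : ℂ) ≤ inner ℂ (asymptoticLimit T hT x) x := ge_of_tendsto' h1 h2
  have h4 := Complex.nonneg_iff.mp h3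
  exact ⟨Complex.ext (by simp) (by simpa using h4.2), h4.1⟩

theorem tendsto_norm_adjoint_pow_sq (T : H →L[ℂ] H) (hT : ‖T‖ ≤ 1) (x : H) :
    Tendsto (fun n => ‖(adjoint T ^ n) x‖ ^ 2) atTop (𝓝 (‖Qop T hT x‖ ^ 2)) := by
  have hQQ : Qop T hT * Qop T hT = asymptoticLimit T hT :=
    CFC.sqrt_mul_sqrt_self _ (asymptoticLimit_nonneg T hT)
  have hsa : adjoint (Qop T hT) = Qop T hT :=
    (IsSelfAdjoint.of_nonneg (CFC.sqrt_nonneg (asymptoticLimit T hT))).adjoint_eq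
  have e : inner ℂ (asymptoticLimit T hT x) x = inner ℂ (Qop T hT x) (Qop T hT x) := by
    rw [← hQQ, mul_apply_eq_comp]
    nth_rewrite 1 [← hsa]
    rw [adjoint_inner_left]
  have h1 : Tendsto (fun n => RCLike.re (inner ℂ ((T ^ n * adjoint T ^ n) x) x)) atTop
      (𝓝 (RCLike.re (inner ℂ (asymptoticLimit T hT x) x))) :=
    (RCLike.continuous_re.tendsto _).comp
      ((tendsto_asymptoticLimit T hT x).inner tendsto_const_nhds)
  rw [e, ← norm_sq_eq_re_inner] at h1
  simpa only [re_inner_pow_mul_adjoint_pow] using h1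

theorem norm_Qop_adjoint (T : H →L[ℂ] H) (hT : ‖T‖ ≤ 1) (h : H) :
    ‖Qop T hT (adjoint T h)‖ = ‖Qop T hT h‖ := by
  have h1 := tendsto_norm_adjoint_pow_sq T hT (adjoint T h)
  have h2 := (tendsto_add_atTop_iff_nat 1).mpr (tendsto_norm_adjoint_pow_sq T hT h)
  simp only [pow_succ (adjoint T), mul_apply_eq_comp] at h2
  rw [← sq_eq_sq₀ (norm_nonneg _) (norm_nonneg _)]
  exact tendsto_nhds_unique h1 h2

/-! ### The minimal unitary extension -/

/-- The closure of the range of `Q_{T*}`. -/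
def RanQ (T : H →L[ℂ] H) (hT : ‖T‖ ≤ 1) : Submodule ℂ H :=
  (LinearMap.range (Qop T hT).toLinearMap).topologicalClosure

instance (T : H →L[ℂ] H) (hT : ‖T‖ ≤ 1) : CompleteSpace (RanQ T hT) :=
  inferInstanceAs
    (CompleteSpace (LinearMap.range (Qop T hT).toLinearMap).topologicalClosure)

/-- `Q_{T*}` as an operator from `H` to the closure of its range. -/
def Qmap (T : H →L[ℂ] H) (hT : ‖T‖ ≤ 1) : H →L[ℂ] RanQ T hT :=
  (Qop T hT).codRestrict (RanQ T hT) fun h => Submodule.le_topologicalClosure _ ⟨h, rfl⟩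

theorem denseRange_Qmap (T : H →L[ℂ] H) (hT : ‖T‖ ≤ 1) : DenseRange (Qmap T hT) := by
  rintro ⟨x, hx⟩
  rw [closure_subtype]
  have h1 : x ∈ closure (LinearMap.range (Qop T hT).toLinearMap : Set H) := hx
  refine closure_mono ?_ h1
  rintro _ ⟨h, rfl⟩
  exact ⟨Qmap T hT h, ⟨h, rfl⟩, rfl⟩

/-- The isometry `X*` on the closure of the range of `Q_{T*}` which extends
`Q_{T*} h ↦ Q_{T*} T* h` by continuity. -/
def Xstar (T : H →L[ℂ] H) (hT : ‖T‖ ≤ 1) : RanQ T hT →L[ℂ] RanQ T hT :=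
  (Qmap T hT ∘L adjoint T).toLinearMap.extendOfNorm (Qmap T hT).toLinearMap

theorem Xstar_Qmap (T : H →L[ℂ] H) (hT : ‖T‖ ≤ 1) (h : H) :
    Xstar T hT (Qmap T hT h) = Qmap T hT (adjoint T h) :=
  LinearMap.extendOfNorm_eq (denseRange_Qmap T hT)
    ⟨1, fun x => by rw [one_mul]; exact (norm_Qop_adjoint T hT x).le⟩ h

theorem norm_Xstar (T : H →L[ℂ] H) (hT : ‖T‖ ≤ 1) (x : RanQ T hT) : ‖Xstar T hT x‖ = ‖x‖ := by
  refine (denseRange_Qmap T hT).induction_on (p := fun x => ‖Xstar T hT x‖ = ‖x‖) x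
    (isClosed_eq (by fun_prop) (by fun_prop)) fun h => ?_
  rw [Xstar_Qmap]
  exact norm_Qop_adjoint T hT h

/-- The orthogonal complement of the range of `X*` in the closure of the range of `Q_{T*}`. -/
def CoRange (T : H →L[ℂ] H) (hT : ‖T‖ ≤ 1) : Submodule ℂ (RanQ T hT) :=
  (LinearMap.range (Xstar T hT).toLinearMap)ᗮ

instance (T : H →L[ℂ] H) (hT : ‖T‖ ≤ 1) : CompleteSpace (CoRange T hT) :=
  inferInstanceAs (CompleteSpace ((LinearMap.range (Xstar T hT).toLinearMap)ᗮ : Submodule ℂ _))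

/-- The space `𝒬_{T*}` of the minimal unitary extension of the isometry `X*`, realized as the
Hilbert space direct sum of the closure `R` of the range of `Q_{T*}` and `H²(R ⊖ X* R)`. -/
abbrev QSpace (T : H →L[ℂ] H) (hT : ‖T‖ ≤ 1) : Type _ :=
  WithLp 2 (RanQ T hT × Hardy (CoRange T hT))

/-- The operator `Q_{T*}` from `H` into `𝒬_{T*}`. -/
def Qemb (T : H →L[ℂ] H) (hT : ‖T‖ ≤ 1) : H →L[ℂ] QSpace T hT :=
  (WithLp.prodContinuousLinearEquiv 2 ℂ _ _).symm.toContinuousLinearMap ∘L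
    (Qmap T hT).prod 0

/-- The unitary operator `W_D` on `𝒬_{T*}`: it sends `(x, f)` to `(X x, p + z f)`, where `p` is the
orthogonal projection of `x` on `R ⊖ X* R`.  Its adjoint `W_D*` sends `(x, f)` to
`(X* x + f(0), (f - f(0)) / z)` and is the minimal unitary extension of `X*`. -/
def WD (T : H →L[ℂ] H) (hT : ‖T‖ ≤ 1) : QSpace T hT →L[ℂ] QSpace T hT :=
  (WithLp.prodContinuousLinearEquiv 2 ℂ _ _).symm.toContinuousLinearMap ∘L
    (adjoint (Xstar T hT) ∘L WithLp.fstL 2 ℂ _ _).prod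
      (Hardy.const (CoRange T hT) ∘L (CoRange T hT).orthogonalProjectionOnto ∘L
          WithLp.fstL 2 ℂ _ _ +
        Hardy.shift (CoRange T hT) ∘L WithLp.sndL 2 ℂ _ _)

theorem adjoint_WD_Qemb (T : H →L[ℂ] H) (hT : ‖T‖ ≤ 1) (h : H) :
    adjoint (WD T hT) (Qemb T hT h) = Qemb T hT (adjoint T h) := by
  refine ext_inner_right ℂ fun y => ?_
  rw [adjoint_inner_left]
  have e1 : inner ℂ (Qemb T hT h) (WD T hT y) =
      inner ℂ (Qmap T hT h) (adjoint (Xstar T hT) y.fst) := by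
    rw [WithLp.prod_inner_apply]
    change inner ℂ (Qmap T hT h) (adjoint (Xstar T hT) y.fst) +
      inner ℂ (0 : Hardy (CoRange T hT)) _ = _
    rw [inner_zero_left, add_zero]
  have e2 : inner ℂ (Qemb T hT (adjoint T h)) y =
      inner ℂ (Qmap T hT (adjoint T h)) y.fst := by
    rw [WithLp.prod_inner_apply]
    change inner ℂ (Qmap T hT (adjoint T h)) y.fst +
      inner ℂ (0 : Hardy (CoRange T hT)) _ = _
    rw [inner_zero_left, add_zero]
  rw [e1, e2, adjoint_inner_right, Xstar_Qmap]

end Contraction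

/-! ### Andô lifts and Andô tuples -/

section Ando

variable {H K K' D F : Type*}
  [NormedAddCommGroup H] [InnerProductSpace ℂ H] [CompleteSpace H]
  [NormedAddCommGroup K] [InnerProductSpace ℂ K] [CompleteSpace K]
  [NormedAddCommGroup K'] [InnerProductSpace ℂ K'] [CompleteSpace K']
  [NormedAddCommGroup D] [InnerProductSpace ℂ D] [CompleteSpace D]
  [NormedAddCommGroup F] [InnerProductSpace ℂ F] [CompleteSpace F]

/-- A commuting pair of contractions. -/
structure IsCommContractivePair (T₁ T₂ : H →L[ℂ] H) : Prop where
  comm : T₁ * T₂ = T₂ * T₁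
  norm_fst_le : ‖T₁‖ ≤ 1
  norm_snd_le : ‖T₂‖ ≤ 1

theorem IsCommContractivePair.norm_mul {T₁ T₂ : H →L[ℂ] H} (h : IsCommContractivePair T₁ T₂) :
    ‖T₁ * T₂‖ ≤ 1 :=
  (norm_mul_le _ _).trans (mul_le_one₀ h.norm_fst_le (norm_nonneg _) h.norm_snd_le)

/-- `(E, V₁, V₂)` is an Andô lift of `(T₁, T₂)`: `E` is an isometric embedding, `V₁`, `V₂` are
commuting isometries, and `Vⱼ* E = E Tⱼ*`. -/
structure IsAndoLift (T₁ T₂ : H →L[ℂ] H) (E : H →L[ℂ] K) (V₁ V₂ : K →L[ℂ] K) : Prop where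
  isometry_emb : Isometry E
  isometry_fst : Isometry V₁
  isometry_snd : Isometry V₂
  comm : V₁ * V₂ = V₂ * V₁
  adjoint_fst : adjoint V₁ ∘L E = E ∘L adjoint T₁
  adjoint_snd : adjoint V₂ ∘L E = E ∘L adjoint T₂

/-- An Andô lift is minimal if the closed linear span of the spaces `V₁ᵐ V₂ⁿ Ran E` is the
whole space. -/
structure IsMinimalAndoLift (T₁ T₂ : H →L[ℂ] H) (E : H →L[ℂ] K) (V₁ V₂ : K →L[ℂ] K) : Prop
    extends IsAndoLift T₁ T₂ E V₁ V₂ where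
  minimal : (Submodule.span ℂ
    {k : K | ∃ (m n : ℕ) (h : H), (V₁ ^ m * V₂ ^ n) (E h) = k}).topologicalClosure = ⊤

/-- Unitary equivalence of two lifts. -/
def LiftsEquivalent (E : H →L[ℂ] K) (V₁ V₂ : K →L[ℂ] K)
    (E' : H →L[ℂ] K') (V₁' V₂' : K' →L[ℂ] K') : Prop :=
  ∃ τ : K ≃ₗᵢ[ℂ] K', (∀ h, τ (E h) = E' h) ∧
    (∀ k, τ (V₁ k) = V₁' (τ k)) ∧ (∀ k, τ (V₂ k) = V₂' (τ k))

/-- Multiplication by `U*(P^⊥ + z P)` on `H²(F)`. -/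
def bclFst (P U : F →L[ℂ] F) : Hardy F →L[ℂ] Hardy F :=
  Hardy.mul (adjoint U * (1 - P)) (adjoint U * P)

/-- Multiplication by `(P + z P^⊥)U` on `H²(F)`. -/
def bclSnd (P U : F →L[ℂ] F) : Hardy F →L[ℂ] Hardy F :=
  Hardy.mul (P * U) ((1 - P) * U)

/-- `(F, Λ, P, U)` is a Type I Andô tuple for `(T₁*, T₂*)`.  Here `T = T₁ T₂` and `Λ` is an isometry
from the defect space `𝒟_{T*}` into `F`. -/
structure IsTypeIAndoTuple (T₁ T₂ : H →L[ℂ] H)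
    (Λ : DefectSpace (adjoint (T₁ * T₂)) →ₗᵢ[ℂ] F) (P U : F →L[ℂ] F) : Prop where
  projection : IsStarProjection P
  unitary : U ∈ unitary (F →L[ℂ] F)
  eq_fst : (1 - P) ∘L U ∘L Λ.toContinuousLinearMap ∘L defectMap (adjoint (T₁ * T₂)) +
      P ∘L U ∘L Λ.toContinuousLinearMap ∘L defectMap (adjoint (T₁ * T₂)) ∘L adjoint (T₁ * T₂) =
    Λ.toContinuousLinearMap ∘L defectMap (adjoint (T₁ * T₂)) ∘L adjoint T₁
  eq_snd : adjoint U ∘L P ∘L Λ.toContinuousLinearMap ∘L defectMap (adjoint (T₁ * T₂)) +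
      adjoint U ∘L (1 - P) ∘L Λ.toContinuousLinearMap ∘L defectMap (adjoint (T₁ * T₂)) ∘L
        adjoint (T₁ * T₂) =
    Λ.toContinuousLinearMap ∘L defectMap (adjoint (T₁ * T₂)) ∘L adjoint T₂

/-- Douglas minimality of `(F, Λ, P, U)`: the only closed subspace of `H²(F)` which contains
`H²(Ran Λ)` and is invariant under both operators of the model is `H²(F)` itself. -/
def IsDouglasMinimal (Λ : D →ₗᵢ[ℂ] F) (P U : F →L[ℂ] F) : Prop :=
  ∀ S : Submodule ℂ (Hardy F), IsClosed (S : Set (Hardy F)) →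
    (∀ f : Hardy F, (∀ z, f z ∈ Set.range Λ) → f ∈ S) →
    (∀ f ∈ S, bclFst P U f ∈ S) → (∀ f ∈ S, bclSnd P U f ∈ S) → S = ⊤

/-- `(W₁, W₂)` is a canonical pair of commuting unitaries on `𝒬_{T*}`, `T = T₁ T₂`. -/
structure IsCanonicalPair {T₁ T₂ : H →L[ℂ] H} (hT : IsCommContractivePair T₁ T₂)
    (W₁ W₂ : QSpace (T₁ * T₂) hT.norm_mul →L[ℂ] QSpace (T₁ * T₂) hT.norm_mul) : Prop where
  unitary_fst : W₁ ∈ unitary (QSpace (T₁ * T₂) hT.norm_mul →L[ℂ] QSpace (T₁ * T₂) hT.norm_mul)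
  unitary_snd : W₂ ∈ unitary (QSpace (T₁ * T₂) hT.norm_mul →L[ℂ] QSpace (T₁ * T₂) hT.norm_mul)
  comm : W₁ * W₂ = W₂ * W₁
  mul_eq : W₁ * W₂ = WD (T₁ * T₂) hT.norm_mul
  adjoint_fst : adjoint W₁ ∘L Qemb (T₁ * T₂) hT.norm_mul =
    Qemb (T₁ * T₂) hT.norm_mul ∘L adjoint T₁
  adjoint_snd : adjoint W₂ ∘L Qemb (T₁ * T₂) hT.norm_mul =
    Qemb (T₁ * T₂) hT.norm_mul ∘L adjoint T₂

/-- The block diagonal operator `A ⊕ B` on a Hilbert space direct sum. -/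
def blockDiag (A : K →L[ℂ] K) (B : K' →L[ℂ] K') : WithLp 2 (K × K') →L[ℂ] WithLp 2 (K × K') :=
  (WithLp.prodContinuousLinearEquiv 2 ℂ K K').symm.toContinuousLinearMap ∘L
    (A ∘L WithLp.fstL 2 ℂ K K').prod (B ∘L WithLp.sndL 2 ℂ K K')

/-- The embedding `h ↦ ((I ⊗ Λ) 𝒪_{D_{T*}, T*} h, Q_{T*} h)` of `H` into `H²(F) ⊕ 𝒬_{T*}`. -/
def douglasEmb {T₁ T₂ : H →L[ℂ] H} (hT : IsCommContractivePair T₁ T₂)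
    (Λ : DefectSpace (adjoint (T₁ * T₂)) →ₗᵢ[ℂ] F) :
    H →L[ℂ] WithLp 2 (Hardy F × QSpace (T₁ * T₂) hT.norm_mul) :=
  (WithLp.prodContinuousLinearEquiv 2 ℂ _ _).symm.toContinuousLinearMap ∘L
    (Hardy.map Λ.toContinuousLinearMap ∘L
      obsOp (adjoint (T₁ * T₂)) (norm_adjoint_le hT.norm_mul)).prod
    (Qemb (T₁ * T₂) hT.norm_mul)

end Ando

end AndoModel

end

universe u v w

noncomputable section

/-! A commuting pair of isometries is understood through the Wold decomposition of the single
isometry V = V₁V₂. On its wandering subspace ker V* = ker V₁* ⊕ V₁ ker V₂* = V₂ ker V₁* ⊕ ker V₂*,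
let U carry the first splitting to the second (V₂ on ker V₁*, V₁* on V₁ ker V₂*) and let P project
on V₂ ker V₁*. The shift part of V is H²(ker V*), where V₁ and V₂ become multiplication by U*(P^⊥ +
zP) and (P + zP^⊥)U (Berger–Coburn–Lebow: `fst_wold`, `snd_wold`).

For a lift E of (T₁, T₂) and T = T₁T₂, the operator (1 - VV*)E has the same norms as D_{T*}. This
defines Λ, and the shift part of E is (I ⊗ Λ)𝒪. Since ‖𝒪h‖² + ‖Q_{T*}h‖² = ‖h‖², the remaining
component of E has the norms of Q_{T*}. Each of these two maps ι satisfies WιT* = ι for an isometry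
W, and for Q_{T*} the vectors Wⁿιh span a dense subspace; hence `IsCyclicMap.exists_linearIsometry`
embeds 𝒬_{T*} in K. Together with the Wold isometry this embeds the whole model, and minimality of
the lift makes the embedding onto. Projecting the lift on H²(F) turns minimality into Douglas
minimality.

The canonical pair comes from the same extension principle: ‖Q_{T*}Tⱼ*h‖ = ‖Q_{T*}h‖, so Tⱼ* extends
to an isometry of 𝒬_{T*} commuting with W_D. The product of the two is W_D*, which makes both
unitary; cyclicity makes them unique.

In the other direction, the tuple equations are the Taylor coefficients of V_{D,j}*Π = ΠTⱼ*, and Πh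
- VΠT*h = (ΛD_{T*}h, 0) for V = V_{D,1}V_{D,2} separates the two summands: the span of the lift
contains H²(Ran Λ), then H²(F) by Douglas minimality, then Q_{T*}h and so all of 𝒬_{T*}. -/

namespace AndoModel

/-! ### Taylor coefficients and monomials in the Hardy space -/

namespace Hardy

variable {E F : Type*} [NormedAddCommGroup E] [InnerProductSpace ℂ E] [CompleteSpace E]
  [NormedAddCommGroup F] [InnerProductSpace ℂ F] [CompleteSpace F]

/-- The `n`-th Taylor coefficient of a Hardy function. -/
def coeff (n : ℕ) : Hardy F →L[ℂ] F :=
  lp.evalCLM ℂ (fun _ : ℕ => F) 2 n ∘L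
    (ofSeq F).symm.toContinuousLinearEquiv.toContinuousLinearMap

theorem coeff_eq (n : ℕ) (f : Hardy F) : coeff n f = (ofSeq F).symm f n := rfl

theorem coeff_ofSeq (n : ℕ) (a : SqSeq F) : coeff n (ofSeq F a) = a n := by
  rw [coeff_eq, LinearIsometryEquiv.symm_apply_apply]

theorem ext_coeff {f g : Hardy F} (h : ∀ n, coeff n f = coeff n g) : f = g :=
  (ofSeq F).symm.injective (lp.ext (funext h))

theorem coeff_mul_zero (A B : E →L[ℂ] F) (f : Hardy E) :
    coeff 0 (mul A B f) = A (coeff 0 f) := by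
  change coeff 0 (ofSeq F (seqMap A ((ofSeq E).symm f) +
    seqShift F (seqMap B ((ofSeq E).symm f)))) = _
  rw [coeff_ofSeq, lp.coeFn_add, Pi.add_apply, seqShift_zero, add_zero]
  rfl

theorem coeff_mul_succ (A B : E →L[ℂ] F) (f : Hardy E) (n : ℕ) :
    coeff (n + 1) (mul A B f) = A (coeff (n + 1) f) + B (coeff n f) := by
  change coeff (n + 1) (ofSeq F (seqMap A ((ofSeq E).symm f) +
    seqShift F (seqMap B ((ofSeq E).symm f)))) = _
  rw [coeff_ofSeq, lp.coeFn_add, Pi.add_apply, seqShift_succ]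
  rfl

theorem coeff_shift_zero (f : Hardy F) : coeff 0 (shift F f) = 0 := coeff_mul_zero _ _ f

theorem coeff_shift_succ (f : Hardy F) (n : ℕ) : coeff (n + 1) (shift F f) = coeff n f :=
  (coeff_mul_succ _ _ f n).trans (zero_add _)

theorem coeff_map (A : E →L[ℂ] F) (f : Hardy E) (n : ℕ) : coeff n (map A f) = A (coeff n f) := by
  cases n with
  | zero => exact coeff_mul_zero _ _ f
  | succ n => exact (coeff_mul_succ _ _ f n).trans (add_zero _)

/-- The function `z ↦ zⁿ x`. -/
def monomial (n : ℕ) : F →L[ℂ] Hardy F :=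
  (ofSeq F).toContinuousLinearEquiv.toContinuousLinearMap ∘L
    lp.singleContinuousLinearMap ℂ (fun _ : ℕ => F) 2 n

theorem const_eq_monomial : const F = monomial 0 := rfl

theorem coeff_monomial_self (n : ℕ) (x : F) : coeff n (monomial n x) = x :=
  (coeff_ofSeq n _).trans (lp.single_apply_self (E := fun _ : ℕ => F) 2 n x)

theorem coeff_monomial_ne {m n : ℕ} (h : m ≠ n) (x : F) : coeff m (monomial n x) = 0 :=
  (coeff_ofSeq m _).trans (lp.single_apply_ne (E := fun _ : ℕ => F) 2 n x h)

theorem hasSum_monomial (f : Hardy F) : HasSum (fun n => monomial n (coeff n f)) f := by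
  have h := lp.hasSum_single (p := 2) (by norm_num) ((ofSeq F).symm f)
  have h2 := (ofSeq F).toContinuousLinearEquiv.toContinuousLinearMap.hasSum h
  convert! h2 using 1
  exact ((ofSeq F).apply_symm_apply f).symm

theorem inner_monomial_left (n : ℕ) (x : F) (f : Hardy F) :
    inner ℂ (monomial n x) f = inner ℂ x (coeff n f) := by
  obtain ⟨a, rfl⟩ := (ofSeq F).surjective f
  rw [coeff_ofSeq]
  exact ((ofSeq F).inner_map_map _ _).trans (lp.inner_single_left n x a)

theorem hasSum_norm_coeff_sq (f : Hardy F) : HasSum (fun n => ‖coeff n f‖ ^ 2) (‖f‖ ^ 2) := by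
  have h := lp.hasSum_norm (by norm_num) ((ofSeq F).symm f)
  simpa [coeff_eq] using h

theorem mul_monomial (A B : E →L[ℂ] F) (n : ℕ) (x : E) :
    mul A B (monomial n x) = monomial n (A x) + monomial (n + 1) (B x) := by
  refine ext_coeff fun k => ?_
  rw [map_add]
  cases k with
  | zero =>
    rw [coeff_mul_zero, coeff_monomial_ne (Nat.succ_ne_zero n).symm, add_zero]
    cases n with
    | zero => rw [coeff_monomial_self, coeff_monomial_self]
    | succ n =>
      rw [coeff_monomial_ne (Nat.succ_ne_zero n).symm, coeff_monomial_ne (Nat.succ_ne_zero n).symm,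
        map_zero]
  | succ k =>
    rw [coeff_mul_succ]
    congr 1
    · by_cases h : k + 1 = n
      · subst h; rw [coeff_monomial_self, coeff_monomial_self]
      · rw [coeff_monomial_ne h, coeff_monomial_ne h, map_zero]
    · by_cases h : k = n
      · subst h; rw [coeff_monomial_self, coeff_monomial_self]
      · rw [coeff_monomial_ne h, coeff_monomial_ne (by omega), map_zero]

theorem shift_monomial (n : ℕ) (x : F) : shift F (monomial n x) = monomial (n + 1) x :=
  (mul_monomial _ _ n x).trans (by simp)

theorem coeff_adjoint_mul (A B : E →L[ℂ] F) (f : Hardy F) (n : ℕ) :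
    coeff n (adjoint (mul A B) f) = adjoint A (coeff n f) + adjoint B (coeff (n + 1) f) := by
  refine ext_inner_left ℂ fun x => ?_
  rw [← inner_monomial_left, adjoint_inner_right, mul_monomial, inner_add_left,
    inner_monomial_left, inner_monomial_left, inner_add_right, adjoint_inner_right,
    adjoint_inner_right]

theorem coeff_adjoint_shift (f : Hardy F) (n : ℕ) :
    coeff n (adjoint (shift F) f) = coeff (n + 1) f := by
  rw [shift, coeff_adjoint_mul, map_zero, adjoint_id]
  exact zero_add _

/-- Reduces membership in a closed subspace, in particular in a preimage of a lift span, to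
monomials. -/
theorem mem_of_monomial_mem {S : Submodule ℂ (Hardy F)} (hS : IsClosed (S : Set (Hardy F)))
    {f : Hardy F} (h : ∀ n, monomial n (coeff n f) ∈ S) : f ∈ S :=
  hS.mem_of_tendsto (hasSum_monomial f) (Eventually.of_forall fun _ => S.sum_mem fun n _ => h n)

/-- A Hardy function with values in a closed subspace has its coefficients there. -/
theorem coeff_mem {L : Submodule ℂ F} (hL : IsClosed (L : Set F)) {f : Hardy F}
    (hf : ∀ z, f z ∈ L) (n : ℕ) : coeff n f ∈ L := by
  have : CompleteSpace L := hL.completeSpace_coe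
  have h : map Lᗮ.starProjection f = 0 := by
    refine ext fun z => ?_
    rw [map_apply, (Submodule.starProjection_apply_eq_zero_iff _).mpr
      (L.le_orthogonal_orthogonal (hf z))]
    rfl
  have h2 := coeff_map Lᗮ.starProjection f n
  rw [h, map_zero, eq_comm, Submodule.starProjection_apply_eq_zero_iff,
    Submodule.orthogonal_orthogonal] at h2
  exact h2

end Hardy

theorem prod_ext {α β : Type*} {p q : WithLp 2 (α × β)} (h₁ : p.fst = q.fst)
    (h₂ : p.snd = q.snd) : p = q :=
  WithLp.ofLp_injective 2 (Prod.ext h₁ h₂)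

/-! ### Extending maps from a cyclic set of vectors -/

section Extension

variable {H K Q : Type*} [NormedAddCommGroup H] [InnerProductSpace ℂ H]
  [NormedAddCommGroup K] [InnerProductSpace ℂ K] [CompleteSpace K]
  [NormedAddCommGroup Q] [InnerProductSpace ℂ Q]

/-- Two linear maps with equal norms, the first one with dense range, differ by an isometry. -/
theorem exists_linearIsometry_of_norm_eq {M : Type*} [AddCommGroup M] [Module ℂ M]
    {e : M →ₗ[ℂ] Q} {e' : M →ₗ[ℂ] K} (hd : DenseRange e) (hn : ∀ x, ‖e' x‖ = ‖e x‖) :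
    ∃ B : Q →ₗᵢ[ℂ] K, ∀ x, B (e x) = e' x := by
  have hB (x) : e'.extendOfNorm e (e x) = e' x :=
    LinearMap.extendOfNorm_eq hd ⟨1, fun x => by rw [one_mul, hn]⟩ x
  refine ⟨⟨(e'.extendOfNorm e).toLinearMap, fun x => ?_⟩, hB⟩
  exact hd.induction_on (p := fun x => ‖e'.extendOfNorm e x‖ = ‖x‖) x
    (isClosed_eq (by fun_prop) (by fun_prop)) fun x => by rw [hB, hn]

/-- The vectors `Wⁿ ι h` span a dense subspace. -/
def IsCyclicMap (ι : H →L[ℂ] Q) (W : Q →L[ℂ] Q) : Prop :=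
  Dense (Submodule.span ℂ {x : Q | ∃ (n : ℕ) (h : H), (W ^ n) (ι h) = x} : Set Q)

omit [CompleteSpace K] in
theorem IsCyclicMap.eq_of_forall {ι : H →L[ℂ] Q} {W : Q →L[ℂ] Q} (hc : IsCyclicMap ι W)
    {A B : Q →L[ℂ] K} (h : ∀ (n : ℕ) (x : H), A ((W ^ n) (ι x)) = B ((W ^ n) (ι x))) : A = B :=
  ContinuousLinearMap.ext_on hc (by rintro _ ⟨n, x, rfl⟩; exact h n x)

theorem Commute.apply_pow_apply {B W : Q →L[ℂ] Q} (h : Commute B W) (n : ℕ) (x : Q) :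
    B ((W ^ n) x) = (W ^ n) (B x) :=
  DFunLike.congr_fun (h.pow_right n).eq x

/-- The commutant of `W` is determined on the range of `ι`; every uniqueness and product identity on
𝒬_{T*} uses this. -/
theorem IsCyclicMap.eq_of_commute {ι : H →L[ℂ] Q} {W : Q →L[ℂ] Q} (hc : IsCyclicMap ι W)
    {A B : Q →L[ℂ] Q} (hA : Commute A W) (hB : Commute B W) (h : ∀ x, A (ι x) = B (ι x)) :
    A = B :=
  hc.eq_of_forall fun n x => by
    rw [Commute.apply_pow_apply hA, Commute.apply_pow_apply hB, h]

theorem IsCyclicMap.mem_of_isClosed {ι : H →L[ℂ] Q} {W : Q →L[ℂ] Q} (hc : IsCyclicMap ι W)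
    {S : Submodule ℂ Q} (hS : IsClosed (S : Set Q)) (hι : ∀ h, ι h ∈ S) (hW : ∀ x ∈ S, W x ∈ S)
    (x : Q) : x ∈ S := by
  refine hS.closure_subset_iff.mpr ?_ (hc x)
  refine Submodule.span_le.mpr ?_
  rintro _ ⟨n, h, rfl⟩
  induction n with
  | zero => exact hι h
  | succ n ih => rw [pow_succ', mul_apply_eq_comp]; exact hW _ ih

/-- Rewrites `ι x` with an arbitrarily high power of `W` in front, so that vectors with different
exponents can be brought to a common one. -/
theorem pow_apply_pow {ι : H →L[ℂ] Q} {W : Q →L[ℂ] Q} {S : H →L[ℂ] H}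
    (h : ∀ x, W (ι (S x)) = ι x) (n : ℕ) (x : H) : (W ^ n) (ι ((S ^ n) x)) = ι x := by
  induction n with
  | zero => rfl
  | succ n ih => rw [pow_succ W, pow_succ' S, mul_apply_eq_comp, mul_apply_eq_comp, h, ih]

theorem norm_pow_apply {W : Q →L[ℂ] Q} (hW : ∀ x, ‖W x‖ = ‖x‖) (n : ℕ) (x : Q) :
    ‖(W ^ n) x‖ = ‖x‖ := by
  induction n with
  | zero => rfl
  | succ n ih => rw [pow_succ', mul_apply_eq_comp, hW, ih]

/-- Two isometric extensions of the same backward dynamics `S`, the first one minimal, are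
intertwined by an isometry as soon as the embeddings have the same norms. -/
theorem IsCyclicMap.exists_linearIsometry {ι : H →L[ℂ] Q} {W : Q →L[ℂ] Q}
    (hc : IsCyclicMap ι W) {ι' : H →L[ℂ] K} {V : K →L[ℂ] K} (S : H →L[ℂ] H)
    (hW : ∀ x, ‖W x‖ = ‖x‖) (hV : ∀ x, ‖V x‖ = ‖x‖)
    (hι : ∀ x, W (ι (S x)) = ι x) (hι' : ∀ x, V (ι' (S x)) = ι' x)
    (hn : ∀ x, ‖ι' x‖ = ‖ι x‖) :
    ∃ B : Q →ₗᵢ[ℂ] K, (∀ x, B (ι x) = ι' x) ∧ ∀ x, B (W x) = V (B x) := by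
  -- Formal finite sums parametrize the two spans at once, so that no well-definedness has to be
  -- checked by hand.
  let e : (ℕ →₀ H) →ₗ[ℂ] Q := Finsupp.lsum ℂ fun n => ((W ^ n) ∘L ι).toLinearMap
  let e' : (ℕ →₀ H) →ₗ[ℂ] K := Finsupp.lsum ℂ fun n => ((V ^ n) ∘L ι').toLinearMap
  have es (n : ℕ) (h : H) : e (Finsupp.single n h) = (W ^ n) (ι h) := Finsupp.lsum_single _ _ _ _
  have es' (n : ℕ) (h : H) : e' (Finsupp.single n h) = (V ^ n) (ι' h) := Finsupp.lsum_single _ _ _ _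
  -- Every finite sum collapses to a single term, with the same `N` and `g` on both sides; equality
  -- of norms then follows from the hypothesis on `ι` and `ι'`.
  have key (f : ℕ →₀ H) : ∃ (N : ℕ) (g : H), e f = (W ^ N) (ι g) ∧ e' f = (V ^ N) (ι' g) := by
    induction f using Finsupp.induction_linear with
    | zero => exact ⟨0, 0, by simp, by simp⟩
    | single n h => exact ⟨n, h, es n h, es' n h⟩
    | add f₁ f₂ h₁ h₂ =>
      obtain ⟨N₁, g₁, h₁, h₁'⟩ := h₁
      obtain ⟨N₂, g₂, h₂, h₂'⟩ := h₂
      -- Each term is raised to the common exponent by the exponent of the other one.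
      refine ⟨N₁ + N₂, (S ^ N₂) g₁ + (S ^ N₁) g₂, ?_, ?_⟩
      · rw [map_add, h₁, h₂, map_add, map_add, pow_add, mul_apply_eq_comp, pow_apply_pow hι,
          ← pow_add, add_comm N₁ N₂, pow_add, mul_apply_eq_comp, pow_apply_pow hι]
      · rw [map_add, h₁', h₂', map_add, map_add, pow_add, mul_apply_eq_comp, pow_apply_pow hι',
          ← pow_add, add_comm N₁ N₂, pow_add, mul_apply_eq_comp, pow_apply_pow hι']
  have hnorm (f : ℕ →₀ H) : ‖e' f‖ = ‖e f‖ := by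
    obtain ⟨N, g, h, h'⟩ := key f
    rw [h, h', norm_pow_apply hW, norm_pow_apply hV, hn]
  have hd : DenseRange e := by
    refine Dense.mono ?_ hc
    change _ ⊆ ((LinearMap.range e : Submodule ℂ Q) : Set Q)
    refine Submodule.span_le.mpr ?_
    rintro _ ⟨n, h, rfl⟩
    exact ⟨Finsupp.single n h, es n h⟩
  obtain ⟨B, hB⟩ := exists_linearIsometry_of_norm_eq hd hnorm
  have hBs (n : ℕ) (h : H) : B ((W ^ n) (ι h)) = (V ^ n) (ι' h) := by rw [← es, hB, es']
  have hBW : B.toContinuousLinearMap ∘L W = V ∘L B.toContinuousLinearMap :=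
    hc.eq_of_forall fun n h => by
      change B (W ((W ^ n) (ι h))) = V (B ((W ^ n) (ι h)))
      rw [hBs, ← mul_apply_eq_comp, ← pow_succ', hBs, pow_succ', mul_apply_eq_comp]
  exact ⟨B, hBs 0, fun x => DFunLike.congr_fun hBW x⟩

end Extension

/-! ### W_D is unitary and minimal over Ran Q_{T*} -/

section MinimalUnitaryExtension

variable {H : Type*} [NormedAddCommGroup H] [InnerProductSpace ℂ H] [CompleteSpace H]
  (T : H →L[ℂ] H) (hT : ‖T‖ ≤ 1)

theorem adjoint_Xstar_mul_self (x : RanQ T hT) : adjoint (Xstar T hT) (Xstar T hT x) = x :=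
  DFunLike.congr_fun ((norm_map_iff_adjoint_comp_self _).mp (norm_Xstar T hT)) x

theorem adjoint_Xstar_CoRange (c : CoRange T hT) : adjoint (Xstar T hT) (c : RanQ T hT) = 0 := by
  refine ext_inner_left ℂ fun y => ?_
  rw [adjoint_inner_right, inner_zero_right]
  exact c.2 _ ⟨y, rfl⟩

theorem orthogonalProjectionOnto_Xstar (x : RanQ T hT) :
    (CoRange T hT).orthogonalProjectionOnto (Xstar T hT x) = 0 :=
  Submodule.orthogonalProjectionOnto_orthogonal_apply_eq_zero ⟨x, rfl⟩

/-- X* is an isometry of a complete space, so its range is closed and splits off orthogonally. -/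
theorem exists_eq_Xstar_add (x : RanQ T hT) : ∃ (y : RanQ T hT) (c : CoRange T hT),
    x = Xstar T hT y + c := by
  have hcl : IsClosed ((LinearMap.range (Xstar T hT).toLinearMap : Submodule ℂ (RanQ T hT)) :
      Set (RanQ T hT)) := by
    have h : Isometry (Xstar T hT) := AddMonoidHomClass.isometry_of_norm _ (norm_Xstar T hT)
    exact h.isClosedEmbedding.isClosed_range
  have : CompleteSpace (LinearMap.range (Xstar T hT).toLinearMap) := hcl.completeSpace_coe
  obtain ⟨_, ⟨y, rfl⟩, z, hz, h⟩ :=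
    (LinearMap.range (Xstar T hT).toLinearMap).exists_add_mem_mem_orthogonal x
  exact ⟨y, ⟨z, hz⟩, h⟩

theorem fst_WD (q : QSpace T hT) : (WD T hT q).fst = adjoint (Xstar T hT) q.fst := rfl

theorem snd_WD (q : QSpace T hT) : (WD T hT q).snd =
    Hardy.const (CoRange T hT) ((CoRange T hT).orthogonalProjectionOnto q.fst) +
      Hardy.shift (CoRange T hT) q.snd := rfl

/-- The constant occupies the coefficient 0, which the shift leaves empty. -/
theorem Hardy.norm_const_add_shift_sq {F : Type*} [NormedAddCommGroup F] [InnerProductSpace ℂ F]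
    [CompleteSpace F] (x : F) (f : Hardy F) :
    ‖Hardy.const F x + Hardy.shift F f‖ ^ 2 = ‖x‖ ^ 2 + ‖f‖ ^ 2 := by
  refine (Hardy.hasSum_norm_coeff_sq _).unique ?_
  rw [← hasSum_nat_add_iff' 1]
  have h := Hardy.hasSum_norm_coeff_sq f
  convert! h using 1
  · funext n
    rw [map_add, Hardy.coeff_shift_succ, Hardy.const_eq_monomial,
      Hardy.coeff_monomial_ne (Nat.succ_ne_zero n), zero_add]
  · rw [Finset.sum_range_one, map_add, Hardy.coeff_shift_zero, Hardy.const_eq_monomial,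
      Hardy.coeff_monomial_self, add_zero]
    ring

/-- If x = X*y + c with c ⊥ Ran X*, then W_D sends (x, f) to (y, c + zf), and ‖x‖² = ‖y‖² + ‖c‖². -/
theorem norm_WD (q : QSpace T hT) : ‖WD T hT q‖ = ‖q‖ := by
  rw [← sq_eq_sq₀ (norm_nonneg _) (norm_nonneg _), WithLp.prod_norm_sq_eq_of_L2,
    WithLp.prod_norm_sq_eq_of_L2, fst_WD, snd_WD, Hardy.norm_const_add_shift_sq]
  obtain ⟨y, c, h⟩ := exists_eq_Xstar_add T hT q.fst
  have e1 : ‖q.fst‖ ^ 2 = ‖y‖ ^ 2 + ‖c‖ ^ 2 := by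
    have hc : inner ℂ (Xstar T hT y) (c : RanQ T hT) = 0 := c.2 _ ⟨y, rfl⟩
    have := norm_add_sq_eq_norm_sq_add_norm_sq_of_inner_eq_zero _ _ hc
    rw [norm_Xstar] at this
    simp only [h, sq]
    exact this
  rw [e1, h, map_add, map_add, adjoint_Xstar_mul_self, adjoint_Xstar_CoRange,
    orthogonalProjectionOnto_Xstar, Submodule.orthogonalProjectionOnto_mem_subspace_eq_self,
    add_zero, zero_add, add_assoc]

theorem surjective_WD : Function.Surjective (WD T hT) := by
  intro q
  -- The preimage is the value of W_D*: (x, f) ↦ (X*x + f(0), (f - f(0))/z).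
  refine ⟨WithLp.toLp 2 (Xstar T hT q.fst + ((Hardy.coeff 0 q.snd : CoRange T hT) : RanQ T hT),
    adjoint (Hardy.shift _) q.snd), prod_ext ?_ (Hardy.ext_coeff fun n => ?_)⟩
  · rw [fst_WD, WithLp.toLp_fst, map_add, adjoint_Xstar_mul_self, adjoint_Xstar_CoRange, add_zero]
  · rw [snd_WD, WithLp.toLp_fst, WithLp.toLp_snd, map_add, map_add, orthogonalProjectionOnto_Xstar,
      Submodule.orthogonalProjectionOnto_mem_subspace_eq_self, zero_add, Hardy.const_eq_monomial]
    cases n with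
    | zero => rw [Hardy.coeff_monomial_self, Hardy.coeff_shift_zero, add_zero]
    | succ n =>
      rw [Hardy.coeff_monomial_ne (Nat.succ_ne_zero n), Hardy.coeff_shift_succ, zero_add]
      exact Hardy.coeff_adjoint_shift _ _

theorem mem_unitary_of_surjective {K : Type*} [NormedAddCommGroup K] [InnerProductSpace ℂ K]
    [CompleteSpace K] {A : K →L[ℂ] K} (hA : ∀ x, ‖A x‖ = ‖x‖) (hs : Function.Surjective A) :
    A ∈ unitary (K →L[ℂ] K) := by
  have h1 : adjoint A ∘L A = 1 := (norm_map_iff_adjoint_comp_self _).mp hA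
  refine Unitary.mem_iff.mpr ⟨h1, ContinuousLinearMap.ext fun x => ?_⟩
  obtain ⟨y, rfl⟩ := hs x
  change A ((adjoint A ∘L A) y) = A y
  rw [h1]
  rfl

theorem WD_mem_unitary : WD T hT ∈ unitary (QSpace T hT →L[ℂ] QSpace T hT) :=
  mem_unitary_of_surjective (norm_WD T hT) (surjective_WD T hT)

theorem WD_adjoint_WD (q : QSpace T hT) : WD T hT (adjoint (WD T hT) q) = q :=
  DFunLike.congr_fun (Unitary.mul_star_self_of_mem (WD_mem_unitary T hT)) q

theorem WD_Qemb_adjoint (h : H) : WD T hT (Qemb T hT (adjoint T h)) = Qemb T hT h := by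
  rw [← adjoint_WD_Qemb, WD_adjoint_WD]

theorem norm_Qemb (h : H) : ‖Qemb T hT h‖ = ‖Qop T hT h‖ := by
  rw [← sq_eq_sq₀ (norm_nonneg _) (norm_nonneg _), WithLp.prod_norm_sq_eq_of_L2]
  change ‖Qop T hT h‖ ^ 2 + ‖(0 : Hardy (CoRange T hT))‖ ^ 2 = _
  rw [norm_zero]; ring

/-- The closed span contains R ⊕ 0 by density of Ran Q_{T*} in R. For c ⊥ Ran X*, W_D moves (c, 0)
to the constant (0, c), because Xc = 0, and then shifts it to every (0, zⁿc). -/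
theorem isCyclicMap_WD : IsCyclicMap (Qemb T hT) (WD T hT) := by
  set N := (Submodule.span ℂ
    {x : QSpace T hT | ∃ (n : ℕ) (h : H), (WD T hT ^ n) (Qemb T hT h) = x}).topologicalClosure
    with hN
  have hcl : IsClosed (N : Set (QSpace T hT)) := Submodule.isClosed_topologicalClosure _
  have hNW (q) (hq : q ∈ N) : WD T hT q ∈ N := by
    have : N ≤ N.comap (WD T hT).toLinearMap := by
      refine Submodule.topologicalClosure_minimal _ (Submodule.span_le.mpr ?_)
        (hcl.preimage (WD T hT).continuous)
      rintro _ ⟨n, h, rfl⟩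
      refine Submodule.le_topologicalClosure _ (Submodule.subset_span ⟨n + 1, h, ?_⟩)
      rw [pow_succ', mul_apply_eq_comp]; rfl
    exact this hq
  let i₁ : RanQ T hT →L[ℂ] QSpace T hT :=
    (WithLp.prodContinuousLinearEquiv 2 ℂ _ _).symm.toContinuousLinearMap ∘L
      (ContinuousLinearMap.id ℂ _).prod 0
  let i₂ : Hardy (CoRange T hT) →L[ℂ] QSpace T hT :=
    (WithLp.prodContinuousLinearEquiv 2 ℂ _ _).symm.toContinuousLinearMap ∘L
      (0 : Hardy (CoRange T hT) →L[ℂ] RanQ T hT).prod (ContinuousLinearMap.id ℂ _)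
  have h₁ (x : RanQ T hT) : i₁ x ∈ N :=
    (denseRange_Qmap T hT).induction_on (p := fun x => i₁ x ∈ N) x
      (hcl.preimage i₁.continuous) fun h =>
        Submodule.le_topologicalClosure _ (Submodule.subset_span ⟨0, h, rfl⟩)
  have hm (c : CoRange T hT) (n : ℕ) : i₂ (Hardy.monomial n c) ∈ N := by
    induction n with
    | zero =>
      have := hNW _ (h₁ c)
      convert! this using 1
      refine prod_ext ?_ ?_
      · rw [fst_WD]
        exact (adjoint_Xstar_CoRange T hT c).symm
      · rw [snd_WD]
        change _ = Hardy.const _ ((CoRange T hT).orthogonalProjectionOnto (c : RanQ T hT)) +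
          Hardy.shift _ (0 : Hardy (CoRange T hT))
        rw [Submodule.orthogonalProjectionOnto_mem_subspace_eq_self, map_zero, add_zero]
        rfl
    | succ n ih =>
      have := hNW _ ih
      convert! this using 1
      refine prod_ext ?_ ?_
      · rw [fst_WD]
        exact (map_zero (adjoint (Xstar T hT))).symm
      · rw [snd_WD]
        change _ = Hardy.const _ ((CoRange T hT).orthogonalProjectionOnto (0 : RanQ T hT)) +
          Hardy.shift _ (Hardy.monomial n c)
        rw [map_zero, map_zero, zero_add, Hardy.shift_monomial]
        rfl
  have h₂ (f : Hardy (CoRange T hT)) : i₂ f ∈ N :=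
    Hardy.mem_of_monomial_mem (S := N.comap i₂.toLinearMap) (hcl.preimage i₂.continuous)
      fun n => hm _ n
  intro q
  change q ∈ N
  have : q = i₁ q.fst + i₂ q.snd :=
    prod_ext (add_zero q.fst).symm (zero_add q.snd).symm
  rw [this]
  exact N.add_mem (h₁ _) (h₂ _)

end MinimalUnitaryExtension

/-! ### The canonical pair of commuting unitaries -/

section CanonicalPair

variable {H : Type*} [NormedAddCommGroup H] [InnerProductSpace ℂ H] [CompleteSpace H]
  {T₁ T₂ : H →L[ℂ] H}

theorem IsCommContractivePair.adjoint_mul_comm (hT : IsCommContractivePair T₁ T₂) :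
    adjoint T₁ * adjoint T₂ = adjoint T₂ * adjoint T₁ := by
  have h := congrArg star hT.comm
  rw [star_mul, star_mul] at h
  exact h.symm

theorem adjoint_mul (A B : H →L[ℂ] H) : adjoint (A * B) = adjoint B * adjoint A := star_mul A B

/-- ‖Q_{T*}h‖ is the limit of ‖T*ⁿh‖, and a contraction commuting with T* does not increase any of
these norms. -/
theorem norm_Qop_apply_le (T : H →L[ℂ] H) (hT : ‖T‖ ≤ 1) {A : H →L[ℂ] H} (hA : ‖A‖ ≤ 1)
    (hc : Commute A (adjoint T)) (h : H) : ‖Qop T hT (A h)‖ ≤ ‖Qop T hT h‖ := by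
  rw [← sq_le_sq₀ (norm_nonneg _) (norm_nonneg _)]
  refine le_of_tendsto_of_tendsto' (tendsto_norm_adjoint_pow_sq T hT _)
    (tendsto_norm_adjoint_pow_sq T hT _) fun n => ?_
  rw [← mul_apply_eq_comp, ← (hc.pow_right n).eq, mul_apply_eq_comp]
  gcongr
  simpa using A.le_of_opNorm_le hA ((adjoint T ^ n) h)

theorem IsCommContractivePair.commute_adjoint_fst (hT : IsCommContractivePair T₁ T₂) :
    Commute (adjoint T₁) (adjoint (T₁ * T₂)) := by
  rw [adjoint_mul]
  exact Commute.mul_right hT.adjoint_mul_comm (Commute.refl _)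

theorem IsCommContractivePair.commute_adjoint_snd (hT : IsCommContractivePair T₁ T₂) :
    Commute (adjoint T₂) (adjoint (T₁ * T₂)) := by
  rw [adjoint_mul]
  exact Commute.mul_right (Commute.refl _) hT.adjoint_mul_comm.symm

/-- Squeezed: ‖Q h‖ = ‖Q T₂*T₁*h‖ ≤ ‖Q T₁*h‖ ≤ ‖Q h‖. -/
theorem IsCommContractivePair.norm_Qop_fst (hT : IsCommContractivePair T₁ T₂) (h : H) :
    ‖Qop (T₁ * T₂) hT.norm_mul (adjoint T₁ h)‖ = ‖Qop (T₁ * T₂) hT.norm_mul h‖ := by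
  refine le_antisymm (norm_Qop_apply_le _ _ (norm_adjoint_le hT.norm_fst_le)
    hT.commute_adjoint_fst h) ?_
  rw [← norm_Qop_adjoint, adjoint_mul, mul_apply_eq_comp]
  exact norm_Qop_apply_le _ _ (norm_adjoint_le hT.norm_snd_le) hT.commute_adjoint_snd _

theorem IsCommContractivePair.norm_Qop_snd (hT : IsCommContractivePair T₁ T₂) (h : H) :
    ‖Qop (T₁ * T₂) hT.norm_mul (adjoint T₂ h)‖ = ‖Qop (T₁ * T₂) hT.norm_mul h‖ := by
  refine le_antisymm (norm_Qop_apply_le _ _ (norm_adjoint_le hT.norm_snd_le)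
    hT.commute_adjoint_snd h) ?_
  rw [← norm_Qop_adjoint, adjoint_mul, ← hT.adjoint_mul_comm, mul_apply_eq_comp]
  exact norm_Qop_apply_le _ _ (norm_adjoint_le hT.norm_fst_le) hT.commute_adjoint_fst _

/-- The factorization A B = W* of a surjective operator makes the isometry A surjective. -/
theorem adjoint_mem_unitary_of_mul_eq {K : Type*} [NormedAddCommGroup K] [InnerProductSpace ℂ K]
    [CompleteSpace K] {A B W : K →L[ℂ] K} (hA : ∀ x, ‖A x‖ = ‖x‖)
    (hW : W ∈ unitary (K →L[ℂ] K)) (h : A * B = adjoint W) :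
    adjoint A ∈ unitary (K →L[ℂ] K) := by
  refine Unitary.star_mem (mem_unitary_of_surjective hA fun x => ⟨B (W x), ?_⟩)
  rw [← mul_apply_eq_comp, h]
  exact DFunLike.congr_fun (Unitary.star_mul_self_of_mem hW) x

theorem eq_of_adjoint_eq {K : Type*} [NormedAddCommGroup K] [InnerProductSpace ℂ K]
    [CompleteSpace K] {A B : K →L[ℂ] K} (h : adjoint A = adjoint B) : A = B := by
  rw [← adjoint_adjoint A, h, adjoint_adjoint]

theorem commute_adjoint_of_mem_unitary {K : Type*} [NormedAddCommGroup K] [InnerProductSpace ℂ K]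
    [CompleteSpace K] {A B : K →L[ℂ] K} (hA : A ∈ unitary (K →L[ℂ] K)) (h : Commute A B) :
    Commute (adjoint A) B := by
  change star A * B = B * star A
  calc star A * B = star A * B * (A * star A) := by
        rw [Unitary.mul_star_self_of_mem hA, mul_one]
    _ = star A * (B * A) * star A := by simp only [mul_assoc]
    _ = star A * A * B * star A := by rw [← h.eq]; simp only [mul_assoc]
    _ = _ := by rw [Unitary.star_mul_self_of_mem hA, one_mul]

omit [CompleteSpace H] in
/-- A map `A` commuting with the backward dynamics `S` of a minimal unitary extension `W` and
preserving the norms of `ι h` extends to an isometry commuting with `W`. -/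
theorem IsCyclicMap.exists_commute {Q : Type*} [NormedAddCommGroup Q] [InnerProductSpace ℂ Q]
    [CompleteSpace Q] {ι : H →L[ℂ] Q} {W : Q →L[ℂ] Q} (hc : IsCyclicMap ι W)
    (hW : ∀ q, ‖W q‖ = ‖q‖) {S A : H →L[ℂ] H} (hι : ∀ x, W (ι (S x)) = ι x) (hA : Commute A S)
    (hn : ∀ x, ‖ι (A x)‖ = ‖ι x‖) :
    ∃ B : Q →L[ℂ] Q, (∀ q, ‖B q‖ = ‖q‖) ∧ (∀ x, B (ι x) = ι (A x)) ∧ Commute B W := by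
  obtain ⟨B, h1, h2⟩ := hc.exists_linearIsometry (ι' := ι ∘L A) (V := W) S hW hW hι
    (fun x => by
      change W (ι ((A * S) x)) = _
      rw [hA.eq]
      exact hι (A x)) hn
  exact ⟨B.toContinuousLinearMap, B.norm_map, h1, ContinuousLinearMap.ext h2⟩

-- The isometric extensions B₁, B₂ of S₁, S₂ and the operator W* all commute with W, so B₁B₂ = W* =
-- B₂B₁ can be checked on the range of `ι`. Both orders are used: one makes B₁ onto, the other B₂.
-- The pair sought is (B₁*, B₂*).
omit [CompleteSpace H] in
theorem IsCyclicMap.exists_unitary_pair {Q : Type*} [NormedAddCommGroup Q] [InnerProductSpace ℂ Q]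
    [CompleteSpace Q] {ι : H →L[ℂ] Q} {W : Q →L[ℂ] Q} (hc : IsCyclicMap ι W)
    (hW : W ∈ unitary (Q →L[ℂ] Q)) {S₁ S₂ : H →L[ℂ] H} (hS : Commute S₁ S₂)
    (hι : ∀ x, adjoint W (ι x) = ι ((S₁ * S₂) x)) (hn₁ : ∀ x, ‖ι (S₁ x)‖ = ‖ι x‖)
    (hn₂ : ∀ x, ‖ι (S₂ x)‖ = ‖ι x‖) :
    ∃ W₁ W₂ : Q →L[ℂ] Q, W₁ ∈ unitary (Q →L[ℂ] Q) ∧ W₂ ∈ unitary (Q →L[ℂ] Q) ∧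
      W₁ * W₂ = W₂ * W₁ ∧ W₁ * W₂ = W ∧ adjoint W₁ ∘L ι = ι ∘L S₁ ∧
      adjoint W₂ ∘L ι = ι ∘L S₂ := by
  have hι' (x : H) : W (ι ((S₁ * S₂) x)) = ι x := by
    rw [← hι]
    exact DFunLike.congr_fun (Unitary.mul_star_self_of_mem hW) _
  obtain ⟨B₁, n₁, q₁, c₁⟩ := hc.exists_commute (norm_map_of_mem_unitary hW) hι'
    ((Commute.refl S₁).mul_right hS) hn₁
  obtain ⟨B₂, n₂, q₂, c₂⟩ := hc.exists_commute (norm_map_of_mem_unitary hW) hι'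
    (hS.symm.mul_right (Commute.refl S₂)) hn₂
  have c₃ := commute_adjoint_of_mem_unitary hW (Commute.refl _)
  have h21 : B₂ * B₁ = adjoint W := hc.eq_of_commute (c₂.mul_left c₁) c₃ fun x => by
    rw [mul_apply_eq_comp, q₁, q₂, hι, hS.eq, mul_apply_eq_comp]
  have h12 : B₁ * B₂ = adjoint W := hc.eq_of_commute (c₁.mul_left c₂) c₃ fun x => by
    rw [mul_apply_eq_comp, q₂, q₁, hι, mul_apply_eq_comp]
  have e12 : adjoint B₁ * adjoint B₂ = W := by rw [← adjoint_mul, h21, adjoint_adjoint]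
  have e21 : adjoint B₂ * adjoint B₁ = W := by rw [← adjoint_mul, h12, adjoint_adjoint]
  refine ⟨adjoint B₁, adjoint B₂, adjoint_mem_unitary_of_mul_eq n₁ hW h12,
    adjoint_mem_unitary_of_mul_eq n₂ hW h21, e12.trans e21.symm, e12, ?_, ?_⟩
  · rw [adjoint_adjoint]; exact ContinuousLinearMap.ext q₁
  · rw [adjoint_adjoint]; exact ContinuousLinearMap.ext q₂

theorem exists_isCanonicalPair (hT : IsCommContractivePair T₁ T₂) :
    ∃ W₁ W₂, IsCanonicalPair hT W₁ W₂ := by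
  obtain ⟨W₁, W₂, u₁, u₂, h₁, h₂, h₃, h₄⟩ :=
    (isCyclicMap_WD (T₁ * T₂) hT.norm_mul).exists_unitary_pair (WD_mem_unitary _ _)
      (S₁ := adjoint T₁) (S₂ := adjoint T₂) hT.adjoint_mul_comm
      (fun x => by rw [adjoint_WD_Qemb, adjoint_mul, ← hT.adjoint_mul_comm])
      (fun x => by rw [norm_Qemb, norm_Qemb, hT.norm_Qop_fst])
      (fun x => by rw [norm_Qemb, norm_Qemb, hT.norm_Qop_snd])
  exact ⟨W₁, W₂, u₁, u₂, h₁, h₂, h₃, h₄⟩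

variable {hT : IsCommContractivePair T₁ T₂}
  {W₁ W₂ : QSpace (T₁ * T₂) hT.norm_mul →L[ℂ] QSpace (T₁ * T₂) hT.norm_mul}

theorem IsCanonicalPair.commute_adjoint_fst (h : IsCanonicalPair hT W₁ W₂) :
    Commute (adjoint W₁) (WD (T₁ * T₂) hT.norm_mul) := by
  refine commute_adjoint_of_mem_unitary h.unitary_fst ?_
  rw [← h.mul_eq]
  exact Commute.mul_right (Commute.refl _) h.comm

theorem IsCanonicalPair.commute_adjoint_snd (h : IsCanonicalPair hT W₁ W₂) :
    Commute (adjoint W₂) (WD (T₁ * T₂) hT.norm_mul) := by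
  refine commute_adjoint_of_mem_unitary h.unitary_snd ?_
  rw [← h.mul_eq]
  exact Commute.mul_right h.comm.symm (Commute.refl _)

theorem IsCanonicalPair.unique {W₁' W₂'} (h : IsCanonicalPair hT W₁ W₂)
    (h' : IsCanonicalPair hT W₁' W₂') : W₁ = W₁' ∧ W₂ = W₂' := by
  constructor
  · exact eq_of_adjoint_eq ((isCyclicMap_WD _ _).eq_of_commute h.commute_adjoint_fst
      h'.commute_adjoint_fst fun x => DFunLike.congr_fun (h.adjoint_fst.trans h'.adjoint_fst.symm) x)
  · exact eq_of_adjoint_eq ((isCyclicMap_WD _ _).eq_of_commute h.commute_adjoint_snd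
      h'.commute_adjoint_snd fun x => DFunLike.congr_fun (h.adjoint_snd.trans h'.adjoint_snd.symm) x)

theorem existsUnique_isCanonicalPair (hT : IsCommContractivePair T₁ T₂) :
    ∃! W : (QSpace (T₁ * T₂) hT.norm_mul →L[ℂ] QSpace (T₁ * T₂) hT.norm_mul) ×
      (QSpace (T₁ * T₂) hT.norm_mul →L[ℂ] QSpace (T₁ * T₂) hT.norm_mul),
      IsCanonicalPair hT W.1 W.2 := by
  obtain ⟨W₁, W₂, h⟩ := exists_isCanonicalPair hT
  exact ⟨(W₁, W₂), h, fun W hW => Prod.ext (hW.unique h).1 (hW.unique h).2⟩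

end CanonicalPair

/-! ### The Berger–Coburn–Lebow multiplication operators -/

section BCL

variable {F : Type*} [NormedAddCommGroup F] [InnerProductSpace ℂ F] [CompleteSpace F]

/-- The hypotheses say that the symbol A + zB satisfies (A + zB)*(A + zB) = 1 on the unit circle,
which is an identity between the coefficients of 1, z and z̄. -/
theorem Hardy.norm_mul_apply {E F : Type*} [NormedAddCommGroup E] [InnerProductSpace ℂ E]
    [CompleteSpace E] [NormedAddCommGroup F] [InnerProductSpace ℂ F] [CompleteSpace F]
    {A B : E →L[ℂ] F} (h₁ : ∀ x, adjoint A (A x) + adjoint B (B x) = x)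
    (h₂ : ∀ x, adjoint A (B x) = 0) (h₃ : ∀ x, adjoint B (A x) = 0) (f : Hardy E) :
    ‖Hardy.mul A B f‖ = ‖f‖ := by
  refine (norm_map_iff_adjoint_comp_self (Hardy.mul A B)).mpr
    (ContinuousLinearMap.ext fun f => Hardy.ext_coeff fun n => ?_) f
  change Hardy.coeff n (adjoint (Hardy.mul A B) (Hardy.mul A B f)) = Hardy.coeff n f
  rw [Hardy.coeff_adjoint_mul, Hardy.coeff_mul_succ, map_add, h₃, zero_add]
  cases n with
  | zero => rw [Hardy.coeff_mul_zero, h₁]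
  | succ n => rw [Hardy.coeff_mul_succ, map_add, h₂, add_zero, h₁]

/-- The hypotheses are the coefficients of (A + zB)(C + zD) = z. -/
theorem Hardy.mul_mul_eq_shift {A B C D : F →L[ℂ] F} (h₀ : A * C = 0) (h₁ : A * D + B * C = 1)
    (h₂ : B * D = 0) : Hardy.mul A B * Hardy.mul C D = Hardy.shift F := by
  have e₀ (x : F) : A (C x) = 0 := DFunLike.congr_fun h₀ x
  have e₁ (x : F) : A (D x) + B (C x) = x := DFunLike.congr_fun h₁ x
  have e₂ (x : F) : B (D x) = 0 := DFunLike.congr_fun h₂ x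
  refine ContinuousLinearMap.ext fun f => Hardy.ext_coeff fun n => ?_
  rw [mul_apply_eq_comp]
  cases n with
  | zero => rw [Hardy.coeff_mul_zero, Hardy.coeff_mul_zero, e₀, Hardy.coeff_shift_zero]
  | succ n =>
    rw [Hardy.coeff_mul_succ, Hardy.coeff_mul_succ, map_add, e₀, zero_add, Hardy.coeff_shift_succ]
    cases n with
    | zero => rw [Hardy.coeff_mul_zero, e₁]
    | succ n => rw [Hardy.coeff_mul_succ, map_add, e₂, add_zero, e₁]

variable {P U : F →L[ℂ] F} (hP : IsStarProjection P) (hU : U ∈ unitary (F →L[ℂ] F))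

theorem mul_unitary_cancel (hU : U ∈ unitary (F →L[ℂ] F)) (X Y : F →L[ℂ] F) :
    X * U * (adjoint U * Y) = X * Y := by
  rw [mul_assoc, ← mul_assoc U]
  change X * (U * star U * Y) = _
  rw [Unitary.mul_star_self_of_mem hU, one_mul]

theorem unitary_conj_cancel (hU : U ∈ unitary (F →L[ℂ] F)) {X Y Z W : F →L[ℂ] F}
    (h : X * Y + Z * W = 1) :
    adjoint U * X * (Y * U) + adjoint U * Z * (W * U) = 1 := by
  calc _ = adjoint U * (X * Y + Z * W) * U := by simp only [mul_add, add_mul, mul_assoc]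
    _ = 1 := by rw [h, mul_one]; exact Unitary.star_mul_self_of_mem hU

include hP in
theorem adjoint_projection : adjoint P = P := hP.isSelfAdjoint

include hP in
theorem adjoint_one_sub_projection : adjoint (1 - P) = 1 - P := hP.one_sub.isSelfAdjoint

include hP in
theorem adjoint_adjoint_mul_projection : adjoint (adjoint U * P) = P * U := by
  rw [adjoint_mul, adjoint_adjoint, adjoint_projection hP]

include hP in
theorem adjoint_adjoint_mul_one_sub : adjoint (adjoint U * (1 - P)) = (1 - P) * U := by
  rw [adjoint_mul, adjoint_adjoint, adjoint_one_sub_projection hP]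

include hP in
theorem adjoint_projection_mul : adjoint (P * U) = adjoint U * P := by
  rw [adjoint_mul, adjoint_projection hP]

include hP in
theorem adjoint_one_sub_mul : adjoint ((1 - P) * U) = adjoint U * (1 - P) := by
  rw [adjoint_mul, adjoint_one_sub_projection hP]

include hP hU in
theorem norm_bclFst (f : Hardy F) : ‖bclFst P U f‖ = ‖f‖ := by
  refine Hardy.norm_mul_apply (fun x => ?_) (fun x => ?_) (fun x => ?_) f <;>
    simp only [adjoint_adjoint_mul_projection hP, adjoint_adjoint_mul_one_sub hP,
      ← mul_apply_eq_comp, ← _root_.add_apply, mul_unitary_cancel hU]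
  · rw [hP.isIdempotentElem.eq, hP.one_sub.isIdempotentElem.eq, sub_add_cancel]; rfl
  · rw [hP.one_sub_mul_self]; rfl
  · rw [hP.mul_one_sub_self]; rfl

include hP hU in
theorem norm_bclSnd (f : Hardy F) : ‖bclSnd P U f‖ = ‖f‖ := by
  have h0 {X Y : F →L[ℂ] F} (h : X * Y = 0) : adjoint U * X * (Y * U) = 0 := by
    rw [mul_assoc, ← mul_assoc X, h, zero_mul, mul_zero]
  refine Hardy.norm_mul_apply (fun x => ?_) (fun x => ?_) (fun x => ?_) f <;>
    simp only [adjoint_projection_mul hP, adjoint_one_sub_mul hP, ← mul_apply_eq_comp,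
      ← _root_.add_apply]
  · rw [unitary_conj_cancel hU]
    · rfl
    · rw [hP.isIdempotentElem.eq, hP.one_sub.isIdempotentElem.eq, add_sub_cancel]
  · rw [h0 hP.mul_one_sub_self]; rfl
  · rw [h0 hP.one_sub_mul_self]; rfl

-- U*(P^⊥ + zP)(P + zP^⊥)U = U*(zI)U = zI.
include hP hU in
theorem bclFst_mul_bclSnd : bclFst P U * bclSnd P U = Hardy.shift F := by
  have h0 {X Y : F →L[ℂ] F} (h : X * Y = 0) : adjoint U * X * (Y * U) = 0 := by
    rw [mul_assoc, ← mul_assoc X, h, zero_mul, mul_zero]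
  refine Hardy.mul_mul_eq_shift (h0 hP.one_sub_mul_self) (unitary_conj_cancel hU ?_)
    (h0 hP.mul_one_sub_self)
  rw [hP.isIdempotentElem.eq, hP.one_sub.isIdempotentElem.eq, sub_add_cancel]

include hP hU in
theorem bclSnd_mul_bclFst : bclSnd P U * bclFst P U = Hardy.shift F := by
  refine Hardy.mul_mul_eq_shift ?_ ?_ ?_
  · rw [mul_unitary_cancel hU, hP.mul_one_sub_self]
  · rw [mul_unitary_cancel hU, mul_unitary_cancel hU, hP.isIdempotentElem.eq,
      hP.one_sub.isIdempotentElem.eq, add_sub_cancel]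
  · rw [mul_unitary_cancel hU, hP.one_sub_mul_self]

include hP in
theorem coeff_adjoint_bclFst (f : Hardy F) (n : ℕ) :
    Hardy.coeff n (adjoint (bclFst P U) f) =
      (1 - P) (U (Hardy.coeff n f)) + P (U (Hardy.coeff (n + 1) f)) := by
  rw [bclFst, Hardy.coeff_adjoint_mul, adjoint_adjoint_mul_projection hP,
    adjoint_adjoint_mul_one_sub hP]
  rfl

include hP in
theorem coeff_adjoint_bclSnd (f : Hardy F) (n : ℕ) :
    Hardy.coeff n (adjoint (bclSnd P U) f) =
      adjoint U (P (Hardy.coeff n f)) + adjoint U ((1 - P) (Hardy.coeff (n + 1) f)) := by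
  rw [bclSnd, Hardy.coeff_adjoint_mul, adjoint_projection_mul hP, adjoint_one_sub_mul hP]
  rfl

end BCL

/-! ### Column and block diagonal operators on a direct sum -/

section Direct

variable {H G Q : Type*} [NormedAddCommGroup H] [InnerProductSpace ℂ H]
  [NormedAddCommGroup G] [InnerProductSpace ℂ G] [NormedAddCommGroup Q] [InnerProductSpace ℂ Q]

/-- The column operator `h ↦ (α h, ι h)` into a Hilbert space direct sum. -/
def column (α : H →L[ℂ] G) (ι : H →L[ℂ] Q) : H →L[ℂ] WithLp 2 (G × Q) :=
  (WithLp.prodContinuousLinearEquiv 2 ℂ G Q).symm.toContinuousLinearMap ∘L α.prod ι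

theorem norm_column_sq (α : H →L[ℂ] G) (ι : H →L[ℂ] Q) (h : H) :
    ‖column α ι h‖ ^ 2 = ‖α h‖ ^ 2 + ‖ι h‖ ^ 2 :=
  WithLp.prod_norm_sq_eq_of_L2 _

theorem norm_blockDiag {A : G →L[ℂ] G} {B : Q →L[ℂ] Q} (hA : ∀ x, ‖A x‖ = ‖x‖)
    (hB : ∀ x, ‖B x‖ = ‖x‖) (x : WithLp 2 (G × Q)) : ‖blockDiag A B x‖ = ‖x‖ := by
  rw [← sq_eq_sq₀ (norm_nonneg _) (norm_nonneg _), WithLp.prod_norm_sq_eq_of_L2,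
    WithLp.prod_norm_sq_eq_of_L2]
  change ‖A x.fst‖ ^ 2 + ‖B x.snd‖ ^ 2 = _
  rw [hA, hB]

theorem blockDiag_mul (A A' : G →L[ℂ] G) (B B' : Q →L[ℂ] Q) :
    blockDiag A B * blockDiag A' B' = blockDiag (A * A') (B * B') := rfl

theorem adjoint_blockDiag [CompleteSpace G] [CompleteSpace Q] (A : G →L[ℂ] G) (B : Q →L[ℂ] Q) :
    adjoint (blockDiag A B) = blockDiag (adjoint A) (adjoint B) := by
  refine ((eq_adjoint_iff _ _).mpr fun x y => ?_).symm
  rw [WithLp.prod_inner_apply, WithLp.prod_inner_apply]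
  change inner ℂ (adjoint A x.fst) y.fst + inner ℂ (adjoint B x.snd) y.snd =
    inner ℂ x.fst (A y.fst) + inner ℂ x.snd (B y.snd)
  rw [adjoint_inner_left, adjoint_inner_left]

/-- The embedding of the first summand. -/
abbrev inl (G Q : Type*) [NormedAddCommGroup G] [InnerProductSpace ℂ G] [NormedAddCommGroup Q]
    [InnerProductSpace ℂ Q] : G →L[ℂ] WithLp 2 (G × Q) :=
  column (ContinuousLinearMap.id ℂ G) 0

/-- The embedding of the second summand. -/
abbrev inr (G Q : Type*) [NormedAddCommGroup G] [InnerProductSpace ℂ G] [NormedAddCommGroup Q]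
    [InnerProductSpace ℂ Q] : Q →L[ℂ] WithLp 2 (G × Q) :=
  column 0 (ContinuousLinearMap.id ℂ Q)

theorem inl_add_inr (x : WithLp 2 (G × Q)) : inl G Q x.fst + inr G Q x.snd = x :=
  prod_ext (add_zero _) (zero_add _)

theorem blockDiag_inl (A : G →L[ℂ] G) (B : Q →L[ℂ] Q) (x : G) :
    blockDiag A B (inl G Q x) = inl G Q (A x) :=
  prod_ext rfl (map_zero B)

theorem blockDiag_inr (A : G →L[ℂ] G) (B : Q →L[ℂ] Q) (x : Q) :
    blockDiag A B (inr G Q x) = inr G Q (B x) :=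
  prod_ext (map_zero A) rfl

end Direct

/-! ### The invariant subspace generated by a lift -/

section LiftSpan

variable {H K : Type*} [NormedAddCommGroup H] [InnerProductSpace ℂ H]
  [NormedAddCommGroup K] [InnerProductSpace ℂ K]

/-- The closed linear span of the spaces `V₁ᵐ V₂ⁿ Ran E`. -/
def liftSpan (E : H →L[ℂ] K) (V₁ V₂ : K →L[ℂ] K) : Submodule ℂ K :=
  (Submodule.span ℂ {k : K | ∃ (m n : ℕ) (h : H), (V₁ ^ m * V₂ ^ n) (E h) = k}).topologicalClosure

variable {E : H →L[ℂ] K} {V₁ V₂ : K →L[ℂ] K}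

theorem isClosed_liftSpan : IsClosed (liftSpan E V₁ V₂ : Set K) :=
  Submodule.isClosed_topologicalClosure _

theorem mem_liftSpan (h : H) : E h ∈ liftSpan E V₁ V₂ :=
  Submodule.le_topologicalClosure _ (Submodule.subset_span ⟨0, 0, h, rfl⟩)

theorem liftSpan_le {S : Submodule ℂ K} (hS : IsClosed (S : Set K)) (hE : ∀ h, E h ∈ S)
    (h₁ : ∀ x ∈ S, V₁ x ∈ S) (h₂ : ∀ x ∈ S, V₂ x ∈ S) : liftSpan E V₁ V₂ ≤ S := by
  refine Submodule.topologicalClosure_minimal _ (Submodule.span_le.mpr ?_) hS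
  have hp {V : K →L[ℂ] K} (hV : ∀ x ∈ S, V x ∈ S) (n : ℕ) : ∀ x ∈ S, (V ^ n) x ∈ S := by
    induction n with
    | zero => exact fun x hx => hx
    | succ n ih =>
      intro x hx
      rw [pow_succ', mul_apply_eq_comp]
      exact hV _ (ih x hx)
  rintro _ ⟨m, n, h, rfl⟩
  exact hp h₁ m _ (hp h₂ n _ (hE h))

theorem liftSpan_map {V : K →L[ℂ] K}
    (h : ∀ (m n : ℕ), ∃ m' n' : ℕ, V * (V₁ ^ m * V₂ ^ n) = V₁ ^ m' * V₂ ^ n') {x : K}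
    (hx : x ∈ liftSpan E V₁ V₂) : V x ∈ liftSpan E V₁ V₂ := by
  have : liftSpan E V₁ V₂ ≤ (liftSpan E V₁ V₂).comap V.toLinearMap := by
    refine Submodule.topologicalClosure_minimal _ (Submodule.span_le.mpr ?_)
      (isClosed_liftSpan.preimage V.continuous)
    rintro _ ⟨m, n, y, rfl⟩
    obtain ⟨m', n', e⟩ := h m n
    refine Submodule.le_topologicalClosure _ (Submodule.subset_span ⟨m', n', y, ?_⟩)
    rw [← e]
    rfl
  exact this hx

theorem fst_mem_liftSpan {x : K} (hx : x ∈ liftSpan E V₁ V₂) : V₁ x ∈ liftSpan E V₁ V₂ :=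
  liftSpan_map (fun m n => ⟨m + 1, n, by rw [pow_succ', mul_assoc]⟩) hx

theorem snd_mem_liftSpan (hc : V₁ * V₂ = V₂ * V₁) {x : K} (hx : x ∈ liftSpan E V₁ V₂) :
    V₂ x ∈ liftSpan E V₁ V₂ :=
  liftSpan_map (fun m n => ⟨m, n + 1, by
    rw [← mul_assoc, (show Commute V₂ V₁ from hc.symm).pow_right m |>.eq, mul_assoc,
      ← pow_succ']⟩) hx

end LiftSpan

/-! ### A Douglas-minimal tuple gives a minimal lift -/

section DouglasModel

variable {H : Type*} [NormedAddCommGroup H] [InnerProductSpace ℂ H] [CompleteSpace H]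

theorem denseRange_defectMap (T : H →L[ℂ] H) : DenseRange (defectMap T) := by
  rintro ⟨x, hx⟩
  rw [closure_subtype]
  have h1 : x ∈ closure (LinearMap.range (defectOp T).toLinearMap : Set H) := hx
  refine closure_mono ?_ h1
  rintro _ ⟨h, rfl⟩
  exact ⟨defectMap T h, ⟨h, rfl⟩, rfl⟩

theorem coeff_obsOp (S : H →L[ℂ] H) (hS : ‖S‖ ≤ 1) (h : H) (n : ℕ) :
    Hardy.coeff n (obsOp S hS h) = defectMap S ((S ^ n) h) :=
  Hardy.coeff_ofSeq n (obsSeq S hS h)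

/-- The sum of ‖D_{T*}T*ⁿh‖² = ‖T*ⁿh‖² - ‖T*ⁿ⁺¹h‖² telescopes, and what is left over tends to
‖Q_{T*}h‖². -/
theorem norm_obsOp_sq_add (T : H →L[ℂ] H) (hT : ‖T‖ ≤ 1) (h : H) :
    ‖obsOp (adjoint T) (norm_adjoint_le hT) h‖ ^ 2 + ‖Qop T hT h‖ ^ 2 = ‖h‖ ^ 2 := by
  have h1 := (Hardy.hasSum_norm_coeff_sq (obsOp (adjoint T) (norm_adjoint_le hT) h)).tendsto_sum_nat
  simp only [coeff_obsOp, sum_norm_defectMap_sq (norm_adjoint_le hT)] at h1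
  have h2 := tendsto_nhds_unique h1
    (tendsto_const_nhds.sub (tendsto_norm_adjoint_pow_sq T hT h))
  rw [h2, sub_add_cancel]

theorem Hardy.norm_map_linearIsometry {D F : Type*} [NormedAddCommGroup D] [InnerProductSpace ℂ D]
    [CompleteSpace D] [NormedAddCommGroup F] [InnerProductSpace ℂ F] [CompleteSpace F]
    (Λ : D →ₗᵢ[ℂ] F) (f : Hardy D) : ‖Hardy.map Λ.toContinuousLinearMap f‖ = ‖f‖ := by
  rw [← sq_eq_sq₀ (norm_nonneg _) (norm_nonneg _)]
  refine (Hardy.hasSum_norm_coeff_sq _).unique ?_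
  convert! Hardy.hasSum_norm_coeff_sq f using 2 with n
  rw [Hardy.coeff_map]
  exact congrArg (· ^ 2) (Λ.norm_map _)

variable {F Q : Type*} [NormedAddCommGroup F] [InnerProductSpace ℂ F] [CompleteSpace F]
  [NormedAddCommGroup Q] [InnerProductSpace ℂ Q] [CompleteSpace Q] {T₁ T₂ : H →L[ℂ] H}

/-- The operator `(I ⊗ Λ) 𝒪_{D_{T*}, T*}`, where `T = T₁ T₂`. -/
abbrev obsEmb (hT : IsCommContractivePair T₁ T₂)
    (Λ : DefectSpace (adjoint (T₁ * T₂)) →ₗᵢ[ℂ] F) : H →L[ℂ] Hardy F :=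
  Hardy.map Λ.toContinuousLinearMap ∘L
    obsOp (adjoint (T₁ * T₂)) (norm_adjoint_le hT.norm_mul)

variable (hT : IsCommContractivePair T₁ T₂) {Λ : DefectSpace (adjoint (T₁ * T₂)) →ₗᵢ[ℂ] F}
  {P U : F →L[ℂ] F}

theorem coeff_obsEmb (h : H) (n : ℕ) : Hardy.coeff n (obsEmb hT Λ h) =
    Λ (defectMap (adjoint (T₁ * T₂)) ((adjoint (T₁ * T₂) ^ n) h)) := by
  change Hardy.coeff n (Hardy.map _ (obsOp _ _ h)) = _
  rw [Hardy.coeff_map, coeff_obsOp]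
  rfl

theorem norm_obsEmb_sq (h : H) :
    ‖obsEmb hT Λ h‖ ^ 2 = ‖h‖ ^ 2 - ‖Qop (T₁ * T₂) hT.norm_mul h‖ ^ 2 := by
  rw [← norm_obsOp_sq_add (T₁ * T₂) hT.norm_mul h, add_sub_cancel_right]
  exact congrArg (· ^ 2) (Hardy.norm_map_linearIsometry Λ _)

/-- The `n`-th Taylor coefficient of this identity is the first tuple equation evaluated at T*ⁿh. -/
theorem adjoint_bclFst_obsEmb (ht : IsTypeIAndoTuple T₁ T₂ Λ P U) (h : H) :
    adjoint (bclFst P U) (obsEmb hT Λ h) = obsEmb hT Λ (adjoint T₁ h) := by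
  refine Hardy.ext_coeff fun n => ?_
  rw [coeff_adjoint_bclFst ht.projection, coeff_obsEmb, coeff_obsEmb, coeff_obsEmb,
    ← Commute.apply_pow_apply hT.commute_adjoint_fst, pow_succ', mul_apply_eq_comp]
  exact DFunLike.congr_fun ht.eq_fst ((adjoint (T₁ * T₂) ^ n) h)

theorem adjoint_bclSnd_obsEmb (ht : IsTypeIAndoTuple T₁ T₂ Λ P U) (h : H) :
    adjoint (bclSnd P U) (obsEmb hT Λ h) = obsEmb hT Λ (adjoint T₂ h) := by
  refine Hardy.ext_coeff fun n => ?_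
  rw [coeff_adjoint_bclSnd ht.projection, coeff_obsEmb, coeff_obsEmb, coeff_obsEmb,
    ← Commute.apply_pow_apply hT.commute_adjoint_snd, pow_succ', mul_apply_eq_comp]
  exact DFunLike.congr_fun ht.eq_snd ((adjoint (T₁ * T₂) ^ n) h)

/-- Passing from h to T*h drops the first term of the series ∑ zⁿΛD_{T*}T*ⁿh; shifting back and
subtracting leaves only that term. -/
theorem obsEmb_sub_shift (h : H) :
    obsEmb hT Λ h - Hardy.shift F (obsEmb hT Λ (adjoint (T₁ * T₂) h)) =
      Hardy.monomial 0 (Λ (defectMap (adjoint (T₁ * T₂)) h)) := by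
  refine Hardy.ext_coeff fun n => ?_
  rw [map_sub, coeff_obsEmb]
  cases n with
  | zero => rw [Hardy.coeff_shift_zero, sub_zero, Hardy.coeff_monomial_self]; rfl
  | succ n =>
    rw [Hardy.coeff_shift_succ, coeff_obsEmb, Hardy.coeff_monomial_ne (Nat.succ_ne_zero n),
      pow_succ, mul_apply_eq_comp, sub_self]

variable {ι : H →L[ℂ] Q} {W₁ W₂ : Q →L[ℂ] Q}

/-- The triple built from a Type I tuple and a pair of unitary operators is an Andô lift. -/
theorem isAndoLift_model (ht : IsTypeIAndoTuple T₁ T₂ Λ P U)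
    (hι : ∀ h, ‖ι h‖ = ‖Qop (T₁ * T₂) hT.norm_mul h‖)
    (u₁ : W₁ ∈ unitary (Q →L[ℂ] Q)) (u₂ : W₂ ∈ unitary (Q →L[ℂ] Q)) (hc : W₁ * W₂ = W₂ * W₁)
    (a₁ : adjoint W₁ ∘L ι = ι ∘L adjoint T₁) (a₂ : adjoint W₂ ∘L ι = ι ∘L adjoint T₂) :
    IsAndoLift T₁ T₂ (column (obsEmb hT Λ) ι) (blockDiag (bclFst P U) W₁)
      (blockDiag (bclSnd P U) W₂) where
  isometry_emb := AddMonoidHomClass.isometry_of_norm _ fun h => by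
    rw [← sq_eq_sq₀ (norm_nonneg _) (norm_nonneg _), norm_column_sq, norm_obsEmb_sq, hι,
      sub_add_cancel]
  isometry_fst := AddMonoidHomClass.isometry_of_norm _
    (norm_blockDiag (norm_bclFst ht.projection ht.unitary) (norm_map_of_mem_unitary u₁))
  isometry_snd := AddMonoidHomClass.isometry_of_norm _
    (norm_blockDiag (norm_bclSnd ht.projection ht.unitary) (norm_map_of_mem_unitary u₂))
  comm := by
    rw [blockDiag_mul, blockDiag_mul, bclFst_mul_bclSnd ht.projection ht.unitary,
      bclSnd_mul_bclFst ht.projection ht.unitary, hc]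
  adjoint_fst := by
    rw [adjoint_blockDiag]
    exact ContinuousLinearMap.ext fun h =>
      prod_ext (adjoint_bclFst_obsEmb hT ht h) (DFunLike.congr_fun a₁ h)
  adjoint_snd := by
    rw [adjoint_blockDiag]
    exact ContinuousLinearMap.ext fun h =>
      prod_ext (adjoint_bclSnd_obsEmb hT ht h) (DFunLike.congr_fun a₂ h)

-- The span is invariant under the product of the two model isometries, which is shift ⊕ W₁W₂. This
-- first isolates H² ⊕ 0, and then 0 ⊕ Q by subtraction.
omit [CompleteSpace Q] in
theorem liftSpan_model_eq_top (ht : IsTypeIAndoTuple T₁ T₂ Λ P U) (hm : IsDouglasMinimal Λ P U)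
    (hc : W₁ * W₂ = W₂ * W₁) (hcyc : IsCyclicMap ι (W₁ * W₂))
    (hW : ∀ h, (W₁ * W₂) (ι (adjoint (T₁ * T₂) h)) = ι h) :
    liftSpan (column (obsEmb hT Λ) ι) (blockDiag (bclFst P U) W₁)
      (blockDiag (bclSnd P U) W₂) = ⊤ := by
  have hV : blockDiag (bclFst P U) W₁ * blockDiag (bclSnd P U) W₂ =
      blockDiag (Hardy.shift F) (W₁ * W₂) := by
    rw [blockDiag_mul, bclFst_mul_bclSnd ht.projection ht.unitary]
  have hV' : blockDiag (bclSnd P U) W₂ * blockDiag (bclFst P U) W₁ =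
      blockDiag (Hardy.shift F) (W₁ * W₂) := by
    rw [blockDiag_mul, bclSnd_mul_bclFst ht.projection ht.unitary, hc]
  set N := liftSpan (column (obsEmb hT Λ) ι) (blockDiag (bclFst P U) W₁)
      (blockDiag (bclSnd P U) W₂)
  have hN : IsClosed (N : Set (WithLp 2 (Hardy F × Q))) := isClosed_liftSpan
  have h₁ {x} (hx : x ∈ N) : blockDiag (bclFst P U) W₁ x ∈ N := fst_mem_liftSpan hx
  have h₂ {x} (hx : x ∈ N) : blockDiag (bclSnd P U) W₂ x ∈ N :=
    snd_mem_liftSpan (hV.trans hV'.symm) hx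
  have h₁₂ {x} (hx : x ∈ N) : blockDiag (Hardy.shift F) (W₁ * W₂) x ∈ N := by
    rw [← hV]; exact h₁ (h₂ hx)
  have hmon (n : ℕ) (d : DefectSpace (adjoint (T₁ * T₂))) :
      inl (Hardy F) Q (Hardy.monomial n (Λ d)) ∈ N := by
    refine (denseRange_defectMap _).induction_on
      (p := fun d => inl (Hardy F) Q (Hardy.monomial n (Λ d)) ∈ N) d
      (hN.preimage ((inl (Hardy F) Q).continuous.comp
        ((Hardy.monomial n).continuous.comp Λ.continuous))) fun h => ?_
    induction n with
    | zero =>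
      -- Πh - VΠT*h: the components in `Q` cancel by `hW`, and the constant ΛD_{T*}h remains.
      have := N.sub_mem (mem_liftSpan h) (h₁₂ (mem_liftSpan (adjoint (T₁ * T₂) h)))
      convert! this using 1
      exact prod_ext (obsEmb_sub_shift hT h).symm ((sub_eq_zero.mpr (hW h).symm).symm)
    | succ n ih =>
      rw [← Hardy.shift_monomial, ← blockDiag_inl (Hardy.shift F) (W₁ * W₂)]
      exact h₁₂ ih
  have hrange (f : Hardy F) (hf : ∀ z, f z ∈ Set.range Λ) : inl (Hardy F) Q f ∈ N := by
    have hcl : IsClosed ((LinearMap.range Λ.toLinearMap : Submodule ℂ F) : Set F) :=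
      Λ.isometry.isClosedEmbedding.isClosed_range
    refine Hardy.mem_of_monomial_mem (S := N.comap (inl (Hardy F) Q).toLinearMap)
      (hN.preimage (inl (Hardy F) Q).continuous) fun n => ?_
    obtain ⟨d, hd⟩ := Hardy.coeff_mem hcl hf n
    rw [← hd]
    exact hmon n d
  -- Douglas minimality is applied to the closed subspace of those f with (f, 0) in `N`.
  have hl : N.comap (inl (Hardy F) Q).toLinearMap = ⊤ :=
    hm _ (hN.preimage (inl (Hardy F) Q).continuous) hrange
      (fun f hf => by
        change inl (Hardy F) Q (bclFst P U f) ∈ N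
        rw [← blockDiag_inl _ W₁]
        exact h₁ hf)
      (fun f hf => by
        change inl (Hardy F) Q (bclSnd P U f) ∈ N
        rw [← blockDiag_inl _ W₂]
        exact h₂ hf)
  have hl' (f : Hardy F) : inl (Hardy F) Q f ∈ N :=
    (hl ▸ Submodule.mem_top : f ∈ N.comap (inl (Hardy F) Q).toLinearMap)
  have hr (q : Q) : inr (Hardy F) Q q ∈ N := by
    refine hcyc.mem_of_isClosed (S := N.comap (inr (Hardy F) Q).toLinearMap)
      (hN.preimage (inr (Hardy F) Q).continuous) (fun h => ?_) (fun x hx => ?_) q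
    -- With H² ⊕ 0 inside `N`, removing the first component of Πh leaves (0, ιh).
    · have := N.sub_mem (mem_liftSpan h) (hl' (obsEmb hT Λ h))
      change inr (Hardy F) Q (ι h) ∈ N
      convert! this using 1
      refine prod_ext ?_ ?_
      · exact (sub_self (obsEmb hT Λ h)).symm
      · exact (sub_zero (ι h)).symm
    · change inr (Hardy F) Q ((W₁ * W₂) x) ∈ N
      rw [← blockDiag_inr (Hardy.shift F)]
      exact h₁₂ hx
  refine eq_top_iff.mpr fun x _ => ?_
  rw [← inl_add_inr x]
  exact N.add_mem (hl' _) (hr _)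

end DouglasModel

/-! ### The shift part of the Wold decomposition -/

section Wold

variable {K : Type*} [NormedAddCommGroup K] [InnerProductSpace ℂ K] [CompleteSpace K]

omit [CompleteSpace K] in
theorem Hardy.ext_monomial {F : Type*} [NormedAddCommGroup F] [InnerProductSpace ℂ F]
    [CompleteSpace F] {A B : Hardy F →L[ℂ] K}
    (h : ∀ n x, A (Hardy.monomial n x) = B (Hardy.monomial n x)) : A = B :=
  ContinuousLinearMap.ext fun f =>
    (A.hasSum (Hardy.hasSum_monomial f)).unique (by
      simp only [h]
      exact B.hasSum (Hardy.hasSum_monomial f))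

/-- The wandering subspace `ker V*` of an isometry `V`. -/
def wandering (V : K →L[ℂ] K) : Submodule ℂ K := LinearMap.ker (adjoint V).toLinearMap

theorem isClosed_wandering (V : K →L[ℂ] K) : IsClosed (wandering V : Set K) :=
  (adjoint V).isClosed_ker

instance (V : K →L[ℂ] K) : CompleteSpace (wandering V) := (isClosed_wandering V).completeSpace_coe

variable {V : K →L[ℂ] K}

theorem adjoint_wandering (x : wandering V) : adjoint V (x : K) = 0 := x.2

theorem adjoint_apply_self (hV : ∀ x, ‖V x‖ = ‖x‖) (x : K) : adjoint V (V x) = x :=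
  DFunLike.congr_fun ((norm_map_iff_adjoint_comp_self _).mp hV) x

theorem inner_apply_apply (hV : ∀ x, ‖V x‖ = ‖x‖) (x y : K) :
    inner ℂ (V x) (V y) = inner ℂ x y := by
  rw [← adjoint_inner_right, adjoint_apply_self hV]

/-- Cancelling Vⁱ leaves the inner product of x with a vector in Ran V, and x ∈ ker V* is orthogonal
to Ran V. -/
theorem inner_pow_apply_wandering (hV : ∀ x, ‖V x‖ = ‖x‖) {i j : ℕ} (hij : i < j)
    (x : wandering V) (y : K) : inner ℂ ((V ^ i) (x : K)) ((V ^ j) y) = 0 := by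
  obtain ⟨d, rfl⟩ := Nat.exists_eq_add_of_lt hij
  rw [add_assoc, pow_add, mul_apply_eq_comp, inner_apply_apply (norm_pow_apply hV i), pow_succ',
    mul_apply_eq_comp, ← adjoint_inner_left, adjoint_wandering, inner_zero_left]

theorem orthogonalFamily_wandering (hV : ∀ x, ‖V x‖ = ‖x‖) :
    OrthogonalFamily ℂ (fun _ : ℕ => wandering V) fun n =>
      (⟨((V ^ n) ∘L (wandering V).subtypeL).toLinearMap, fun x => norm_pow_apply hV n x⟩ :
        wandering V →ₗᵢ[ℂ] K) := by
  intro i j hij x y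
  change inner ℂ ((V ^ i) (x : K)) ((V ^ j) (y : K)) = 0
  rcases hij.lt_or_gt with h | h
  · exact inner_pow_apply_wandering hV h x y
  · rw [← inner_conj_symm, inner_pow_apply_wandering hV h y x, map_zero]

/-- The isometry `∑ zⁿ xₙ ↦ ∑ Vⁿ xₙ` onto the shift part of the Wold decomposition of `V`. -/
def wold (V : K →L[ℂ] K) (hV : ∀ x, ‖V x‖ = ‖x‖) : Hardy (wandering V) →ₗᵢ[ℂ] K :=
  (orthogonalFamily_wandering hV).linearIsometry.comp
    (Hardy.ofSeq (wandering V)).symm.toLinearIsometry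

variable (hV : ∀ x, ‖V x‖ = ‖x‖)

theorem wold_monomial (n : ℕ) (x : wandering V) :
    wold V hV (Hardy.monomial n x) = (V ^ n) (x : K) := by
  change (orthogonalFamily_wandering hV).linearIsometry
    ((Hardy.ofSeq _).symm (Hardy.ofSeq _ (lp.single 2 n x))) = _
  rw [LinearIsometryEquiv.symm_apply_apply, OrthogonalFamily.linearIsometry_apply_single]
  rfl

theorem wold_monomial_add (n : ℕ) (x y : wandering V) :
    wold V hV (Hardy.monomial n x + Hardy.monomial (n + 1) y) = (V ^ n) ((x : K) + V (y : K)) := by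
  rw [map_add, wold_monomial, wold_monomial, map_add, pow_succ, mul_apply_eq_comp]

theorem wold_eq_of_monomial {A : K →L[ℂ] K} {M : Hardy (wandering V) →L[ℂ] Hardy (wandering V)}
    (h : ∀ n (x : wandering V), A ((V ^ n) (x : K)) = wold V hV (M (Hardy.monomial n x)))
    (f : Hardy (wandering V)) : A (wold V hV f) = wold V hV (M f) := by
  have : A ∘L (wold V hV).toContinuousLinearMap = (wold V hV).toContinuousLinearMap ∘L M :=
    Hardy.ext_monomial fun n x => by
      change A (wold V hV _) = wold V hV _
      rw [wold_monomial, h]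
      rfl
  exact DFunLike.congr_fun this f

theorem apply_wold (f : Hardy (wandering V)) : V (wold V hV f) = wold V hV (Hardy.shift _ f) :=
  wold_eq_of_monomial hV (fun n x => by
    rw [Hardy.shift_monomial, wold_monomial, pow_succ', mul_apply_eq_comp]) f

/-- The coefficients of the shift part of a vector. -/
def woldAdjoint (V : K →L[ℂ] K) (hV : ∀ x, ‖V x‖ = ‖x‖) : K →L[ℂ] Hardy (wandering V) :=
  adjoint (wold V hV).toContinuousLinearMap

theorem inner_coeff_woldAdjoint (k : K) (n : ℕ) (x : wandering V) :
    inner ℂ x (Hardy.coeff n (woldAdjoint V hV k)) = inner ℂ ((V ^ n) (x : K)) k := by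
  rw [← Hardy.inner_monomial_left, woldAdjoint, adjoint_inner_right, ← wold_monomial hV]
  rfl

theorem inner_woldAdjoint (f : Hardy (wandering V)) (k : K) :
    inner ℂ f (woldAdjoint V hV k) = inner ℂ (wold V hV f) k :=
  adjoint_inner_right _ _ _

theorem woldAdjoint_wold (f : Hardy (wandering V)) : woldAdjoint V hV (wold V hV f) = f :=
  DFunLike.congr_fun ((norm_map_iff_adjoint_comp_self _).mp (wold V hV).norm_map) f

/-- Valid for every vector, not only those in the shift part; it shows that V preserves the
orthogonal complement of the shift part. -/
theorem woldAdjoint_apply (k : K) :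
    woldAdjoint V hV (V k) = Hardy.shift _ (woldAdjoint V hV k) := by
  refine Hardy.ext_coeff fun n => ext_inner_left ℂ fun x => ?_
  rw [inner_coeff_woldAdjoint]
  cases n with
  | zero =>
    rw [Hardy.coeff_shift_zero, inner_zero_right, pow_zero]
    exact (inner_pow_apply_wandering hV zero_lt_one x k)
  | succ n =>
    rw [Hardy.coeff_shift_succ, pow_succ', mul_apply_eq_comp, inner_apply_apply hV,
      inner_coeff_woldAdjoint]

end Wold

/-! ### The Berger–Coburn–Lebow model of a commuting pair of isometries -/

section CommutingIsometries

variable {K : Type*} [NormedAddCommGroup K] [InnerProductSpace ℂ K] [CompleteSpace K]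

/-- A commuting pair of isometries. -/
structure IsCommIsometricPair (V₁ V₂ : K →L[ℂ] K) : Prop where
  norm_fst : ∀ x, ‖V₁ x‖ = ‖x‖
  norm_snd : ∀ x, ‖V₂ x‖ = ‖x‖
  comm : V₁ * V₂ = V₂ * V₁

variable {V₁ V₂ : K →L[ℂ] K} (h : IsCommIsometricPair V₁ V₂)

namespace IsCommIsometricPair

include h

omit [CompleteSpace K] in
theorem norm_mul (x : K) : ‖(V₁ * V₂) x‖ = ‖x‖ := (h.norm_fst _).trans (h.norm_snd x)

theorem adj_fst (x : K) : adjoint V₁ (V₁ x) = x := adjoint_apply_self h.norm_fst x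

theorem adj_snd (x : K) : adjoint V₂ (V₂ x) = x := adjoint_apply_self h.norm_snd x

omit [CompleteSpace K] in
theorem swap (x : K) : V₂ (V₁ x) = V₁ (V₂ x) := (DFunLike.congr_fun h.comm x).symm

theorem adj_swap (x : K) : adjoint V₂ (adjoint V₁ x) = adjoint V₁ (adjoint V₂ x) := by
  have := congrArg adjoint h.comm
  rw [adjoint_mul, adjoint_mul] at this
  exact DFunLike.congr_fun this x

theorem adj_snd_mul (x : K) : adjoint V₂ (V₁ (V₂ x)) = V₁ x := by rw [← h.swap, h.adj_snd]

theorem adj_mul (x : K) : adjoint (V₁ * V₂) x = adjoint V₁ (adjoint V₂ x) := by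
  rw [adjoint_mul, ← h.adj_swap]; rfl

theorem mem_wandering {x : K} : x ∈ wandering (V₁ * V₂) ↔ adjoint V₁ (adjoint V₂ x) = 0 := by
  rw [← h.adj_mul]; rfl

theorem wandering_eq_zero (x : wandering (V₁ * V₂)) : adjoint V₁ (adjoint V₂ (x : K)) = 0 :=
  h.mem_wandering.mp x.2

end IsCommIsometricPair

/-- The projection `V₂ V₂*` on the wandering subspace of `V₁ V₂`. -/
def wanderingProj (h : IsCommIsometricPair V₁ V₂) :
    wandering (V₁ * V₂) →L[ℂ] wandering (V₁ * V₂) :=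
  ((V₂ * adjoint V₂) ∘L (wandering (V₁ * V₂)).subtypeL).codRestrict (wandering (V₁ * V₂))
    fun x => h.mem_wandering.mpr (by
      change adjoint V₁ (adjoint V₂ (V₂ (adjoint V₂ (x : K)))) = 0
      rw [h.adj_snd, h.wandering_eq_zero])

/-- The operator `V₁* + V₂ (1 - V₁ V₁*)` on the wandering subspace of `V₁ V₂`. -/
def wanderingUnitary (h : IsCommIsometricPair V₁ V₂) :
    wandering (V₁ * V₂) →L[ℂ] wandering (V₁ * V₂) :=
  ((adjoint V₁ + V₂ * (1 - V₁ * adjoint V₁)) ∘L (wandering (V₁ * V₂)).subtypeL).codRestrict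
    (wandering (V₁ * V₂)) fun x => h.mem_wandering.mpr (by
      change adjoint V₁ (adjoint V₂ (adjoint V₁ (x : K) + V₂ (x - V₁ (adjoint V₁ (x : K))))) = 0
      simp only [map_add, map_sub, h.adj_snd, h.adj_fst, h.adj_swap, h.wandering_eq_zero,
        map_zero, sub_self, add_zero])

/-- The operator `V₂* + V₁ (1 - V₂ V₂*)` on the wandering subspace of `V₁ V₂`. -/
def wanderingUnitaryInv (h : IsCommIsometricPair V₁ V₂) :
    wandering (V₁ * V₂) →L[ℂ] wandering (V₁ * V₂) :=
  ((adjoint V₂ + V₁ * (1 - V₂ * adjoint V₂)) ∘L (wandering (V₁ * V₂)).subtypeL).codRestrict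
    (wandering (V₁ * V₂)) fun x => h.mem_wandering.mpr (by
      change adjoint V₁ (adjoint V₂ (adjoint V₂ (x : K) + V₁ (x - V₂ (adjoint V₂ (x : K))))) = 0
      simp only [map_add, map_sub, h.adj_snd_mul, h.adj_fst, ← h.adj_swap]
      simp only [h.adj_swap, h.wandering_eq_zero, map_zero, sub_self, add_zero])

theorem coe_wanderingProj (x : wandering (V₁ * V₂)) :
    (wanderingProj h x : K) = V₂ (adjoint V₂ (x : K)) := rfl

theorem coe_wanderingUnitary (x : wandering (V₁ * V₂)) :
    (wanderingUnitary h x : K) =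
      adjoint V₁ (x : K) + (V₂ (x : K) - V₂ (V₁ (adjoint V₁ (x : K)))) := by
  rw [← map_sub]; rfl

theorem coe_wanderingUnitaryInv (x : wandering (V₁ * V₂)) :
    (wanderingUnitaryInv h x : K) =
      adjoint V₂ (x : K) + (V₁ (x : K) - V₁ (V₂ (adjoint V₂ (x : K)))) := by
  rw [← map_sub]; rfl

theorem wanderingUnitary_inv (x : wandering (V₁ * V₂)) :
    wanderingUnitary h (wanderingUnitaryInv h x) = x := by
  refine Subtype.ext ?_
  rw [coe_wanderingUnitary, coe_wanderingUnitaryInv]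
  simp only [map_add, map_sub, h.adj_fst, h.swap, h.wandering_eq_zero, map_zero]
  abel

theorem wanderingUnitaryInv_self (x : wandering (V₁ * V₂)) :
    wanderingUnitaryInv h (wanderingUnitary h x) = x := by
  refine Subtype.ext ?_
  rw [coe_wanderingUnitaryInv, coe_wanderingUnitary]
  simp only [map_add, map_sub, h.adj_snd, h.adj_swap, h.swap, h.adj_snd_mul,
    h.wandering_eq_zero, map_zero]
  abel

theorem adjoint_wanderingUnitary : adjoint (wanderingUnitary h) = wanderingUnitaryInv h := by
  refine ((eq_adjoint_iff _ _).mpr fun x y => ?_).symm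
  change inner ℂ (wanderingUnitaryInv h x : K) (y : K) =
    inner ℂ (x : K) (wanderingUnitary h y : K)
  -- The correction terms in U and in its inverse lie in Ran V₁V₂, so they are orthogonal to
  -- wandering vectors and drop out.
  have e1 : inner ℂ (V₁ (V₂ (adjoint V₂ (x : K)))) (y : K) = 0 := by
    rw [← adjoint_inner_right, ← adjoint_inner_right, h.adj_swap, h.wandering_eq_zero,
      inner_zero_right]
  have e2 : inner ℂ (x : K) (V₂ (V₁ (adjoint V₁ (y : K)))) = 0 := by
    rw [← adjoint_inner_left, ← adjoint_inner_left, h.wandering_eq_zero, inner_zero_left]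
  rw [coe_wanderingUnitary, coe_wanderingUnitaryInv, inner_add_left, inner_sub_left,
    inner_add_right, inner_sub_right, e1, e2, adjoint_inner_left, adjoint_inner_right]
  ring

theorem wanderingUnitary_mem_unitary :
    wanderingUnitary h ∈ unitary (wandering (V₁ * V₂) →L[ℂ] wandering (V₁ * V₂)) := by
  refine Unitary.mem_iff.mpr ⟨?_, ?_⟩
  · change adjoint (wanderingUnitary h) * _ = 1
    rw [adjoint_wanderingUnitary]
    exact ContinuousLinearMap.ext (wanderingUnitaryInv_self h)
  · change _ * adjoint (wanderingUnitary h) = 1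
    rw [adjoint_wanderingUnitary]
    exact ContinuousLinearMap.ext (wanderingUnitary_inv h)

theorem isStarProjection_wanderingProj : IsStarProjection (wanderingProj h) where
  isIdempotentElem := ContinuousLinearMap.ext fun x => Subtype.ext (by
    change V₂ (adjoint V₂ (V₂ (adjoint V₂ (x : K)))) = V₂ (adjoint V₂ (x : K))
    rw [h.adj_snd])
  isSelfAdjoint := by
    refine ((eq_adjoint_iff _ _).mpr fun x y => ?_).symm
    change inner ℂ (V₂ (adjoint V₂ (x : K))) (y : K) = inner ℂ (x : K) (V₂ (adjoint V₂ (y : K)))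
    rw [← adjoint_inner_right, adjoint_inner_left]

/-- P splits U = V₁* + V₂(1 - V₁V₁*) into its two summands: P^⊥U = V₁* and PU = V₂(1 - V₁V₁*). The
same happens to U* with V₁ and V₂ exchanged: U*P = V₂* and U*P^⊥ = V₁(1 - V₂V₂*). -/
theorem coe_one_sub_proj_unitary (x : wandering (V₁ * V₂)) :
    ((1 - wanderingProj h) (wanderingUnitary h x) : K) = adjoint V₁ (x : K) := by
  change (wanderingUnitary h x : K) - V₂ (adjoint V₂ (wanderingUnitary h x : K)) = _
  rw [coe_wanderingUnitary]
  simp only [map_add, map_sub, h.adj_snd, h.adj_swap, h.wandering_eq_zero, map_zero]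
  abel

theorem coe_proj_unitary (x : wandering (V₁ * V₂)) :
    (wanderingProj h (wanderingUnitary h x) : K) =
      V₂ (x : K) - V₂ (V₁ (adjoint V₁ (x : K))) := by
  rw [coe_wanderingProj, coe_wanderingUnitary]
  simp only [map_add, map_sub, h.adj_snd, h.adj_swap, h.wandering_eq_zero, zero_add]

theorem coe_inv_proj (x : wandering (V₁ * V₂)) :
    (wanderingUnitaryInv h (wanderingProj h x) : K) = adjoint V₂ (x : K) := by
  rw [coe_wanderingUnitaryInv, coe_wanderingProj, h.adj_snd, sub_self, add_zero]

theorem coe_inv_one_sub_proj (x : wandering (V₁ * V₂)) :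
    (wanderingUnitaryInv h ((1 - wanderingProj h) x) : K) =
      V₁ (x : K) - V₁ (V₂ (adjoint V₂ (x : K))) := by
  have e : (((1 - wanderingProj h) x : wandering (V₁ * V₂)) : K) =
    (x : K) - V₂ (adjoint V₂ (x : K)) := rfl
  rw [coe_wanderingUnitaryInv, e]
  simp only [map_sub, h.adj_snd]
  abel

/-- The Berger–Coburn–Lebow model of the first isometry on the shift part. -/
theorem fst_wold (f : Hardy (wandering (V₁ * V₂))) :
    V₁ (wold (V₁ * V₂) h.norm_mul f) = wold (V₁ * V₂) h.norm_mul
      (bclFst (wanderingProj h) (wanderingUnitary h) f) := by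
  have hc : Commute V₁ (V₁ * V₂) := (Commute.refl V₁).mul_right h.comm
  refine wold_eq_of_monomial h.norm_mul (fun n x => ?_) f
  rw [bclFst, Hardy.mul_monomial, wold_monomial_add, Commute.apply_pow_apply hc, adjoint_wanderingUnitary]
  congr 1
  -- On a wandering vector the claim is V₁x = V₁(1 - V₂V₂*)x + V₁V₂V₂*x.
  change _ = (wanderingUnitaryInv h ((1 - wanderingProj h) x) : K) +
    V₁ (V₂ (wanderingUnitaryInv h (wanderingProj h x) : K))
  rw [coe_inv_one_sub_proj, coe_inv_proj, sub_add_cancel]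

/-- The Berger–Coburn–Lebow model of the second isometry on the shift part. -/
theorem snd_wold (f : Hardy (wandering (V₁ * V₂))) :
    V₂ (wold (V₁ * V₂) h.norm_mul f) = wold (V₁ * V₂) h.norm_mul
      (bclSnd (wanderingProj h) (wanderingUnitary h) f) := by
  have hc : Commute V₂ (V₁ * V₂) := Commute.mul_right h.comm.symm (Commute.refl V₂)
  refine wold_eq_of_monomial h.norm_mul (fun n x => ?_) f
  rw [bclSnd, Hardy.mul_monomial, wold_monomial_add, Commute.apply_pow_apply hc]
  congr 1
  change _ = (wanderingProj h (wanderingUnitary h x) : K) +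
    V₁ (V₂ ((1 - wanderingProj h) (wanderingUnitary h x) : K))
  rw [coe_one_sub_proj_unitary, coe_proj_unitary, h.swap, sub_add_cancel]

theorem Hardy.coeff_monomial_zero_succ {F : Type*} [NormedAddCommGroup F] [InnerProductSpace ℂ F]
    [CompleteSpace F] (n : ℕ) (x : F) : Hardy.coeff (n + 1) (Hardy.monomial 0 x) = 0 :=
  Hardy.coeff_monomial_ne (Nat.succ_ne_zero n) x

/-- With `snd_wold` this says that the shift part reduces V₂. On Vⁿ⁺¹x = V₂V₁Vⁿx the adjoint just
removes V₂; on a wandering vector V₂*x = U*Px is wandering again. -/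
theorem adjoint_snd_wold (f : Hardy (wandering (V₁ * V₂))) :
    adjoint V₂ (wold (V₁ * V₂) h.norm_mul f) = wold (V₁ * V₂) h.norm_mul
      (adjoint (bclSnd (wanderingProj h) (wanderingUnitary h)) f) := by
  have hP := isStarProjection_wanderingProj h
  have hU := wanderingUnitary_mem_unitary h
  refine wold_eq_of_monomial h.norm_mul (fun n x => ?_) f
  cases n with
  | zero =>
    have e : adjoint (bclSnd (wanderingProj h) (wanderingUnitary h)) (Hardy.monomial 0 x) =
        Hardy.monomial 0 (wanderingUnitaryInv h (wanderingProj h x)) := by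
      refine Hardy.ext_coeff fun n => ?_
      rw [coeff_adjoint_bclSnd hP, Hardy.coeff_monomial_zero_succ, map_zero, map_zero, add_zero,
        adjoint_wanderingUnitary]
      cases n with
      | zero => rw [Hardy.coeff_monomial_self, Hardy.coeff_monomial_self]
      | succ n => simp only [Hardy.coeff_monomial_zero_succ, map_zero]
    rw [e, wold_monomial]
    exact (coe_inv_proj h x).symm
  | succ n =>
    rw [← Hardy.shift_monomial, ← bclSnd_mul_bclFst hP hU, mul_apply_eq_comp,
      adjoint_apply_self (norm_bclSnd hP hU), ← fst_wold, wold_monomial, pow_succ',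
      mul_apply_eq_comp]
    exact h.adj_snd_mul _

theorem adjoint_fst_wold (f : Hardy (wandering (V₁ * V₂))) :
    adjoint V₁ (wold (V₁ * V₂) h.norm_mul f) = wold (V₁ * V₂) h.norm_mul
      (adjoint (bclFst (wanderingProj h) (wanderingUnitary h)) f) := by
  have hP := isStarProjection_wanderingProj h
  have hU := wanderingUnitary_mem_unitary h
  refine wold_eq_of_monomial h.norm_mul (fun n x => ?_) f
  cases n with
  | zero =>
    have e : adjoint (bclFst (wanderingProj h) (wanderingUnitary h)) (Hardy.monomial 0 x) =
        Hardy.monomial 0 ((1 - wanderingProj h) (wanderingUnitary h x)) := by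
      refine Hardy.ext_coeff fun n => ?_
      rw [coeff_adjoint_bclFst hP, Hardy.coeff_monomial_zero_succ, map_zero, map_zero, add_zero]
      cases n with
      | zero => rw [Hardy.coeff_monomial_self, Hardy.coeff_monomial_self]
      | succ n => simp only [Hardy.coeff_monomial_zero_succ, map_zero]
    rw [e, wold_monomial]
    exact (coe_one_sub_proj_unitary h x).symm
  | succ n =>
    rw [← Hardy.shift_monomial, ← bclFst_mul_bclSnd hP hU, mul_apply_eq_comp,
      adjoint_apply_self (norm_bclFst hP hU), ← snd_wold, wold_monomial, pow_succ',
      mul_apply_eq_comp]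
    exact h.adj_fst _

end CommutingIsometries

/-! ### A minimal lift is equivalent to its model -/

section Converse

variable {H K : Type*} [NormedAddCommGroup H] [InnerProductSpace ℂ H] [CompleteSpace H]
  [NormedAddCommGroup K] [InnerProductSpace ℂ K] [CompleteSpace K]
  {T₁ T₂ : H →L[ℂ] H} {E : H →L[ℂ] K} {V₁ V₂ : K →L[ℂ] K}

theorem norm_sub_apply_adjoint_sq {V : K →L[ℂ] K} (hV : ∀ x, ‖V x‖ = ‖x‖) (x : K) :
    ‖x - V (adjoint V x)‖ ^ 2 = ‖x‖ ^ 2 - ‖adjoint V x‖ ^ 2 := by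
  rw [norm_sub_sq (𝕜 := ℂ), ← adjoint_inner_left, hV, ← norm_sq_eq_re_inner]
  ring

omit [CompleteSpace K] in
/-- Two isometries with orthogonal ranges combine to an isometry of the direct sum. -/
theorem exists_linearIsometry_prod {G Q : Type*} [NormedAddCommGroup G] [InnerProductSpace ℂ G]
    [NormedAddCommGroup Q] [InnerProductSpace ℂ Q] (A : G →ₗᵢ[ℂ] K) (B : Q →ₗᵢ[ℂ] K)
    (h : ∀ x y, inner ℂ (A x) (B y) = 0) :
    ∃ J : WithLp 2 (G × Q) →ₗᵢ[ℂ] K, ∀ x, J x = A x.fst + B x.snd := by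
  refine ⟨⟨(A.toContinuousLinearMap ∘L WithLp.fstL 2 ℂ G Q +
    B.toContinuousLinearMap ∘L WithLp.sndL 2 ℂ G Q).toLinearMap, fun x => ?_⟩, fun x => rfl⟩
  change ‖A x.fst + B x.snd‖ = ‖x‖
  rw [← sq_eq_sq₀ (norm_nonneg _) (norm_nonneg _), WithLp.prod_norm_sq_eq_of_L2, sq,
    norm_add_sq_eq_norm_sq_add_norm_sq_of_inner_eq_zero _ _ (h _ _), A.norm_map, B.norm_map, sq, sq]

namespace IsAndoLift

variable (hl : IsAndoLift T₁ T₂ E V₁ V₂)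
include hl

theorem isCommIsometricPair : IsCommIsometricPair V₁ V₂ where
  norm_fst := (AddMonoidHomClass.isometry_iff_norm V₁).mp hl.isometry_fst
  norm_snd := (AddMonoidHomClass.isometry_iff_norm V₂).mp hl.isometry_snd
  comm := hl.comm

theorem norm_emb (x : H) : ‖E x‖ = ‖x‖ :=
  (AddMonoidHomClass.isometry_iff_norm E).mp hl.isometry_emb x

theorem adjoint_fst_apply (x : H) : adjoint V₁ (E x) = E (adjoint T₁ x) :=
  DFunLike.congr_fun hl.adjoint_fst x

theorem adjoint_snd_apply (x : H) : adjoint V₂ (E x) = E (adjoint T₂ x) :=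
  DFunLike.congr_fun hl.adjoint_snd x

theorem adjoint_mul_apply (x : H) : adjoint (V₁ * V₂) (E x) = E (adjoint (T₁ * T₂) x) := by
  rw [adjoint_mul, adjoint_mul, mul_apply_eq_comp, mul_apply_eq_comp, hl.adjoint_fst_apply,
    hl.adjoint_snd_apply]

theorem inner_pow_apply (n : ℕ) (k : K) (x : H) :
    inner ℂ (((V₁ * V₂) ^ n) k) (E x) = inner ℂ k (E ((adjoint (T₁ * T₂) ^ n) x)) := by
  induction n generalizing k with
  | zero => rfl
  | succ n ih =>
    rw [pow_succ, mul_apply_eq_comp, ih, ← adjoint_inner_right, hl.adjoint_mul_apply, pow_succ',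
      mul_apply_eq_comp]

/-- The isometry of the defect space into the wandering subspace given by a lift. -/
theorem exists_defect_isometry :
    ∃ Λ : DefectSpace (adjoint (T₁ * T₂)) →ₗᵢ[ℂ] wandering (V₁ * V₂), ∀ x,
      (Λ (defectMap (adjoint (T₁ * T₂)) x) : K) =
        E x - (V₁ * V₂) (E (adjoint (T₁ * T₂) x)) := by
  have hp := hl.isCommIsometricPair
  -- Contractivity follows from the lift itself: ‖T*x‖ = ‖V*Ex‖ ≤ ‖x‖.
  have hT : ‖T₁ * T₂‖ ≤ 1 := by
    rw [← LinearIsometryEquiv.norm_map (adjoint (𝕜 := ℂ))]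
    refine opNorm_le_bound _ zero_le_one fun x => ?_
    rw [one_mul, ← hl.norm_emb, ← hl.adjoint_mul_apply, ← hl.norm_emb x]
    refine le_of_sq_le_sq ?_ (norm_nonneg _)
    have := norm_sub_apply_adjoint_sq hp.norm_mul (E x)
    nlinarith [sq_nonneg ‖E x - (V₁ * V₂) (adjoint (V₁ * V₂) (E x))‖]
  let δ : H →L[ℂ] wandering (V₁ * V₂) :=
    ((1 - (V₁ * V₂) * adjoint (V₁ * V₂)) ∘L E).codRestrict (wandering (V₁ * V₂)) fun x => by
      change adjoint (V₁ * V₂) (E x - (V₁ * V₂) (adjoint (V₁ * V₂) (E x))) = 0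
      rw [map_sub, adjoint_apply_self hp.norm_mul, sub_self]
  have hδ (x : H) : (δ x : K) = E x - (V₁ * V₂) (adjoint (V₁ * V₂) (E x)) := rfl
  -- ‖(1 - VV*)Ex‖² = ‖x‖² - ‖V*Ex‖² = ‖x‖² - ‖T*x‖² = ‖D_{T*}x‖².
  obtain ⟨Λ, hΛ⟩ := exists_linearIsometry_of_norm_eq
    (e := (defectMap (adjoint (T₁ * T₂))).toLinearMap) (e' := δ.toLinearMap)
    (denseRange_defectMap _) fun x => by
      change ‖(δ x : K)‖ = ‖defectMap _ x‖
      rw [← sq_eq_sq₀ (norm_nonneg _) (norm_nonneg _), hδ, norm_sub_apply_adjoint_sq hp.norm_mul,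
        norm_defectMap_sq (norm_adjoint_le hT), hl.adjoint_mul_apply, hl.norm_emb, hl.norm_emb]
  refine ⟨Λ, fun x => ?_⟩
  rw [← hl.adjoint_mul_apply, ← hδ]
  exact congrArg Subtype.val (hΛ x)

variable {Λ : DefectSpace (adjoint (T₁ * T₂)) →ₗᵢ[ℂ] wandering (V₁ * V₂)}
  (hΛ : ∀ x, (Λ (defectMap (adjoint (T₁ * T₂)) x) : K) =
    E x - (V₁ * V₂) (E (adjoint (T₁ * T₂) x)))
include hΛ

/-- With ΛD_{T*} = (1 - VV*)E and ETⱼ* = Vⱼ*E, both equations become identities between V₁, V₂ and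
their adjoints. The first one is V₁*(1 - VV*)E + V₂(1 - V₁V₁*)(1 - VV*)V*E = (1 - VV*)V₁*E. -/
theorem isTypeIAndoTuple : IsTypeIAndoTuple T₁ T₂ Λ (wanderingProj hl.isCommIsometricPair)
    (wanderingUnitary hl.isCommIsometricPair) where
  projection := isStarProjection_wanderingProj _
  unitary := wanderingUnitary_mem_unitary _
  eq_fst := ContinuousLinearMap.ext fun x => Subtype.ext <| by
    have hp := hl.isCommIsometricPair
    change ((1 - wanderingProj hp) (wanderingUnitary hp
        (Λ (defectMap (adjoint (T₁ * T₂)) x))) : K) +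
      (wanderingProj hp (wanderingUnitary hp
        (Λ (defectMap (adjoint (T₁ * T₂)) (adjoint (T₁ * T₂) x)))) : K) =
      (Λ (defectMap (adjoint (T₁ * T₂)) (adjoint T₁ x)) : K)
    rw [coe_one_sub_proj_unitary, coe_proj_unitary, hΛ, hΛ, hΛ]
    simp only [← hl.adjoint_mul_apply, ← hl.adjoint_fst_apply, hp.adj_mul, mul_apply_eq_comp,
      map_sub, hp.adj_fst, hp.adj_swap, hp.swap]
    abel
  eq_snd := ContinuousLinearMap.ext fun x => Subtype.ext <| by
    have hp := hl.isCommIsometricPair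
    rw [adjoint_wanderingUnitary]
    change (wanderingUnitaryInv hp (wanderingProj hp (Λ (defectMap (adjoint (T₁ * T₂)) x))) : K) +
      (wanderingUnitaryInv hp ((1 - wanderingProj hp)
        (Λ (defectMap (adjoint (T₁ * T₂)) (adjoint (T₁ * T₂) x)))) : K) =
      (Λ (defectMap (adjoint (T₁ * T₂)) (adjoint T₂ x)) : K)
    rw [coe_inv_proj, coe_inv_one_sub_proj, hΛ, hΛ, hΛ]
    simp only [← hl.adjoint_mul_apply, ← hl.adjoint_snd_apply, hp.adj_mul, mul_apply_eq_comp,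
      map_sub, hp.adj_snd_mul, hp.adj_swap, hp.swap]
    abel

variable (hT : IsCommContractivePair T₁ T₂)

/-- The `n`-th wandering coefficient of Ex is (1 - VV*)V*ⁿEx = (1 - VV*)ET*ⁿx = ΛD_{T*}T*ⁿx. -/
theorem woldAdjoint_emb (x : H) :
    woldAdjoint (V₁ * V₂) hl.isCommIsometricPair.norm_mul (E x) = obsEmb hT Λ x := by
  refine Hardy.ext_coeff fun n => ext_inner_left ℂ fun y => ?_
  rw [inner_coeff_woldAdjoint, hl.inner_pow_apply, coeff_obsEmb]
  change _ = inner ℂ (y : K) (Λ (defectMap _ _) : K)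
  rw [hΛ, inner_sub_right, ← adjoint_inner_left (V₁ * V₂), adjoint_wandering, inner_zero_left,
    sub_zero]

/-- The component of the embedding of a lift in the unitary part of the Wold decomposition. -/
def unitaryPart (hl : IsAndoLift T₁ T₂ E V₁ V₂) (hT : IsCommContractivePair T₁ T₂)
    (Λ : DefectSpace (adjoint (T₁ * T₂)) →ₗᵢ[ℂ] wandering (V₁ * V₂)) : H →L[ℂ] K :=
  E - (wold (V₁ * V₂) hl.isCommIsometricPair.norm_mul).toContinuousLinearMap ∘L obsEmb hT Λ

omit hΛ in
theorem unitaryPart_apply (x : H) : hl.unitaryPart hT Λ x =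
    E x - wold (V₁ * V₂) hl.isCommIsometricPair.norm_mul (obsEmb hT Λ x) := rfl

theorem woldAdjoint_unitaryPart (x : H) :
    woldAdjoint (V₁ * V₂) hl.isCommIsometricPair.norm_mul (hl.unitaryPart hT Λ x) = 0 := by
  rw [unitaryPart_apply, map_sub, hl.woldAdjoint_emb hΛ hT, woldAdjoint_wold, sub_self]

/-- Pythagoras for the orthogonal splitting of Ex, compared with `norm_obsEmb_sq`. -/
theorem norm_unitaryPart (x : H) :
    ‖hl.unitaryPart hT Λ x‖ = ‖Qop (T₁ * T₂) hT.norm_mul x‖ := by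
  have h1 : inner ℂ (wold (V₁ * V₂) hl.isCommIsometricPair.norm_mul (obsEmb hT Λ x))
      (hl.unitaryPart hT Λ x) = 0 := by
    rw [← inner_woldAdjoint, hl.woldAdjoint_unitaryPart hΛ hT, inner_zero_right]
  have h2 := norm_add_sq_eq_norm_sq_add_norm_sq_of_inner_eq_zero _ _ h1
  rw [hl.unitaryPart_apply hT, add_sub_cancel, ← hl.unitaryPart_apply hT, hl.norm_emb,
    LinearIsometry.norm_map] at h2
  have h3 := norm_obsEmb_sq hT (Λ := Λ) x
  rw [← sq_eq_sq₀ (norm_nonneg _) (norm_nonneg _)]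
  linarith

/-- Replacing x by T*x and applying V subtracts the same wandering vector ΛD_{T*}x from Ex and from
its shift part. -/
theorem mul_unitaryPart (x : H) :
    (V₁ * V₂) (hl.unitaryPart hT Λ (adjoint (T₁ * T₂) x)) = hl.unitaryPart hT Λ x := by
  have hp := hl.isCommIsometricPair
  have e : wold (V₁ * V₂) hp.norm_mul (obsEmb hT Λ x) - wold (V₁ * V₂) hp.norm_mul
      (Hardy.shift _ (obsEmb hT Λ (adjoint (T₁ * T₂) x))) =
      E x - (V₁ * V₂) (E (adjoint (T₁ * T₂) x)) := by
    rw [← map_sub, obsEmb_sub_shift, wold_monomial, ← hΛ]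
    rfl
  rw [unitaryPart_apply, unitaryPart_apply, map_sub, apply_wold, sub_eq_sub_iff_add_eq_add,
    add_comm]
  exact sub_eq_sub_iff_add_eq_add.mp e

/-- The shift part reduces V₂, so V₂* maps the unitary part of Ex to that of ET₂*x. By
`mul_unitaryPart` the former lies in Ran V ⊆ Ran V₂, where V₂V₂* is the identity. -/
theorem snd_unitaryPart (x : H) :
    V₂ (hl.unitaryPart hT Λ (adjoint T₂ x)) = hl.unitaryPart hT Λ x := by
  have hp := hl.isCommIsometricPair
  have e : adjoint V₂ (hl.unitaryPart hT Λ x) = hl.unitaryPart hT Λ (adjoint T₂ x) := by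
    rw [unitaryPart_apply, map_sub, adjoint_snd_wold hp, hl.adjoint_snd_apply,
      adjoint_bclSnd_obsEmb hT (hl.isTypeIAndoTuple hΛ), ← unitaryPart_apply]
  rw [← e, ← hl.mul_unitaryPart hΛ hT x, mul_apply_eq_comp, hp.adj_snd_mul, hp.swap]

theorem fst_unitaryPart (x : H) :
    V₁ (hl.unitaryPart hT Λ (adjoint T₁ x)) = hl.unitaryPart hT Λ x := by
  have hp := hl.isCommIsometricPair
  have e : adjoint V₁ (hl.unitaryPart hT Λ x) = hl.unitaryPart hT Λ (adjoint T₁ x) := by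
    rw [unitaryPart_apply, map_sub, adjoint_fst_wold hp, hl.adjoint_fst_apply,
      adjoint_bclFst_obsEmb hT (hl.isTypeIAndoTuple hΛ), ← unitaryPart_apply]
  rw [← e, ← hl.mul_unitaryPart hΛ hT x, mul_apply_eq_comp, hp.adj_fst]

end IsAndoLift

variable {Q : Type*} [NormedAddCommGroup Q] [InnerProductSpace ℂ Q] [CompleteSpace Q]
  {ι : H →L[ℂ] Q} {W₁ W₂ : Q →L[ℂ] Q}

theorem apply_adjoint_of_mem_unitary {W : Q →L[ℂ] Q} (hW : W ∈ unitary (Q →L[ℂ] Q)) (x : Q) :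
    W (adjoint W x) = x :=
  DFunLike.congr_fun (Unitary.mul_star_self_of_mem hW) x

/-- A minimal Andô lift is unitarily equivalent to the model lift of its Type I tuple. -/
theorem IsMinimalAndoLift.liftsEquivalent (hT : IsCommContractivePair T₁ T₂)
    (hm : IsMinimalAndoLift T₁ T₂ E V₁ V₂)
    {Λ : DefectSpace (adjoint (T₁ * T₂)) →ₗᵢ[ℂ] wandering (V₁ * V₂)}
    (hΛ : ∀ x, (Λ (defectMap (adjoint (T₁ * T₂)) x) : K) =
      E x - (V₁ * V₂) (E (adjoint (T₁ * T₂) x)))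
    (hcyc : IsCyclicMap ι (W₁ * W₂)) (hι : ∀ h, ‖ι h‖ = ‖Qop (T₁ * T₂) hT.norm_mul h‖)
    (u₁ : W₁ ∈ unitary (Q →L[ℂ] Q)) (u₂ : W₂ ∈ unitary (Q →L[ℂ] Q)) (hc : W₁ * W₂ = W₂ * W₁)
    (a₁ : adjoint W₁ ∘L ι = ι ∘L adjoint T₁) (a₂ : adjoint W₂ ∘L ι = ι ∘L adjoint T₂) :
    LiftsEquivalent E V₁ V₂ (column (obsEmb hT Λ) ι)
      (blockDiag (bclFst (wanderingProj hm.toIsAndoLift.isCommIsometricPair)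
        (wanderingUnitary hm.toIsAndoLift.isCommIsometricPair)) W₁)
      (blockDiag (bclSnd (wanderingProj hm.toIsAndoLift.isCommIsometricPair)
        (wanderingUnitary hm.toIsAndoLift.isCommIsometricPair)) W₂) := by
  have hl := hm.toIsAndoLift
  have hp := hl.isCommIsometricPair
  have w₁ (x : H) : W₁ (ι (adjoint T₁ x)) = ι x := by
    rw [← apply_adjoint_of_mem_unitary u₁ (ι x)]
    exact congrArg W₁ (DFunLike.congr_fun a₁ x).symm
  have w₂ (x : H) : W₂ (ι (adjoint T₂ x)) = ι x := by
    rw [← apply_adjoint_of_mem_unitary u₂ (ι x)]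
    exact congrArg W₂ (DFunLike.congr_fun a₂ x).symm
  have w (x : H) : (W₁ * W₂) (ι (adjoint (T₁ * T₂) x)) = ι x := by
    rw [adjoint_mul, mul_apply_eq_comp, mul_apply_eq_comp, w₂, w₁]
  obtain ⟨ω, hω, hωW⟩ := hcyc.exists_linearIsometry (ι' := hl.unitaryPart hT Λ) (V := V₁ * V₂)
    (adjoint (T₁ * T₂)) (norm_map_of_mem_unitary (mul_mem u₁ u₂)) hp.norm_mul w
    (hl.mul_unitaryPart hΛ hT) fun x => by rw [hl.norm_unitaryPart hΛ hT, hι]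
  have hωpow (n : ℕ) (q : Q) : ω (((W₁ * W₂) ^ n) q) = ((V₁ * V₂) ^ n) (ω q) := by
    induction n with
    | zero => rfl
    | succ n ih => rw [pow_succ', mul_apply_eq_comp, hωW, ih, pow_succ' (V₁ * V₂)]; rfl
  -- Intertwining relations with operators commuting with the two products need checking on the
  -- range of `ι` only.
  have inter {A : Q →L[ℂ] Q} {B : K →L[ℂ] K} (hA : Commute A (W₁ * W₂))
      (hB : Commute B (V₁ * V₂)) (hAB : ∀ x, ω (A (ι x)) = B (hl.unitaryPart hT Λ x)) (q : Q) :
      ω (A q) = B (ω q) := by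
    have : ω.toContinuousLinearMap ∘L A = B ∘L ω.toContinuousLinearMap :=
      hcyc.eq_of_forall fun n x => by
        change ω (A (((W₁ * W₂) ^ n) (ι x))) = B (ω (((W₁ * W₂) ^ n) (ι x)))
        rw [Commute.apply_pow_apply hA, hωpow, hωpow, Commute.apply_pow_apply hB, hAB, hω]
    exact DFunLike.congr_fun this q
  have hω₁ (q : Q) : ω (W₁ q) = V₁ (ω q) := by
    refine inter ((Commute.refl W₁).mul_right hc) ((Commute.refl V₁).mul_right hl.comm)
      (fun x => ?_) q
    -- ωW₁ιx = ωW₁W₂ιT₂*x = V₁V₂u(T₂*x) = V₁u(x), where u is the unitary part.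
    conv_lhs => rw [← w₂ x, ← mul_apply_eq_comp, hωW, hω, mul_apply_eq_comp,
      hl.snd_unitaryPart hΛ hT]
  have hω₂ (q : Q) : ω (W₂ q) = V₂ (ω q) := by
    refine inter (Commute.mul_right hc.symm (Commute.refl W₂))
      (Commute.mul_right hl.comm.symm (Commute.refl V₂)) (fun x => ?_) q
    conv_lhs => rw [← w₁ x, ← mul_apply_eq_comp, ← hc, hωW, hω, hl.comm, mul_apply_eq_comp,
      hl.fst_unitaryPart hΛ hT]
  have horth (f) (q : Q) : inner ℂ (wold (V₁ * V₂) hp.norm_mul f) (ω q) = 0 := by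
    -- The range of ω is generated by vectors Vⁿu(x), all of which stay orthogonal to the shift
    -- part.
    have h0 (n : ℕ) (x : H) : woldAdjoint (V₁ * V₂) hp.norm_mul
        (((V₁ * V₂) ^ n) (hl.unitaryPart hT Λ x)) = 0 := by
      induction n with
      | zero => exact hl.woldAdjoint_unitaryPart hΛ hT x
      | succ n ih => rw [pow_succ', mul_apply_eq_comp, woldAdjoint_apply, ih, map_zero]
    have : woldAdjoint (V₁ * V₂) hp.norm_mul ∘L ω.toContinuousLinearMap = 0 :=
      hcyc.eq_of_forall fun n x => by
        change woldAdjoint (V₁ * V₂) hp.norm_mul (ω (((W₁ * W₂) ^ n) (ι x))) = 0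
        rw [hωpow, hω, h0]
    rw [← inner_woldAdjoint, show woldAdjoint (V₁ * V₂) hp.norm_mul (ω q) = 0 from
      DFunLike.congr_fun this q, inner_zero_right]
  obtain ⟨J, hJ⟩ := exists_linearIsometry_prod (wold (V₁ * V₂) hp.norm_mul) ω horth
  have hJE (x : H) : J (column (obsEmb hT Λ) ι x) = E x := by
    rw [hJ]
    change wold _ _ (obsEmb hT Λ x) + ω (ι x) = E x
    rw [hω, hl.unitaryPart_apply, add_sub_cancel]
  have hJ₁ (y) : J (blockDiag (bclFst (wanderingProj hp) (wanderingUnitary hp)) W₁ y) =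
      V₁ (J y) := by
    rw [hJ, hJ, map_add, fst_wold hp, ← hω₁]
    rfl
  have hJ₂ (y) : J (blockDiag (bclSnd (wanderingProj hp) (wanderingUnitary hp)) W₂ y) =
      V₂ (J y) := by
    rw [hJ, hJ, map_add, snd_wold hp, ← hω₂]
    rfl
  -- The range of J is closed, contains Ran E and is invariant under V₁ and V₂, so minimality forces
  -- it to be K.
  have hsurj : Function.Surjective J := by
    have hle := liftSpan_le (E := E) (V₁ := V₁) (V₂ := V₂) (S := LinearMap.range J.toLinearMap)
      J.isometry.isClosedEmbedding.isClosed_range (fun x => ⟨_, hJE x⟩)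
      (by rintro _ ⟨y, rfl⟩; exact ⟨_, hJ₁ y⟩) (by rintro _ ⟨y, rfl⟩; exact ⟨_, hJ₂ y⟩)
    rw [liftSpan, hm.minimal] at hle
    exact fun k => hle (Submodule.mem_top (x := k))
  refine ⟨(LinearIsometryEquiv.ofSurjective J hsurj).symm, fun x => ?_, fun k => ?_, fun k => ?_⟩
  · rw [LinearIsometryEquiv.symm_apply_eq]
    exact (hJE x).symm
  · rw [LinearIsometryEquiv.symm_apply_eq]
    refine Eq.trans ?_ (hJ₁ _).symm
    exact congrArg V₁ ((LinearIsometryEquiv.ofSurjective J hsurj).apply_symm_apply k).symm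
  · rw [LinearIsometryEquiv.symm_apply_eq]
    refine Eq.trans ?_ (hJ₂ _).symm
    exact congrArg V₂ ((LinearIsometryEquiv.ofSurjective J hsurj).apply_symm_apply k).symm

omit [CompleteSpace Q] in
/-- A tuple whose model lift is equivalent to a minimal one is Douglas-minimal. -/
theorem isDouglasMinimal_of_liftsEquivalent {F : Type*} [NormedAddCommGroup F]
    [InnerProductSpace ℂ F] [CompleteSpace F] (hT : IsCommContractivePair T₁ T₂)
    {Λ : DefectSpace (adjoint (T₁ * T₂)) →ₗᵢ[ℂ] F} {P U : F →L[ℂ] F}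
    (hm : IsMinimalAndoLift T₁ T₂ E V₁ V₂)
    (he : LiftsEquivalent E V₁ V₂ (column (obsEmb hT Λ) ι) (blockDiag (bclFst P U) W₁)
      (blockDiag (bclSnd P U) W₂)) : IsDouglasMinimal Λ P U := by
  obtain ⟨τ, hE, h₁, h₂⟩ := he
  intro S hS hΛ hf hs
  let π : K →L[ℂ] Hardy F :=
    WithLp.fstL 2 ℂ (Hardy F) Q ∘L τ.toContinuousLinearEquiv.toContinuousLinearMap
  -- The first component of τE takes values in Ran Λ, and the first component of τVⱼ is the model
  -- multiplication operator; hence the preimage of `S` contains the whole span of the lift.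
  have hle : liftSpan E V₁ V₂ ≤ S.comap π.toLinearMap := by
    refine liftSpan_le (hS.preimage π.continuous) (fun x => ?_) (fun x hx => ?_) fun x hx => ?_
    · change (τ (E x)).fst ∈ S
      rw [hE]
      refine hΛ _ fun z => ⟨obsOp _ (norm_adjoint_le hT.norm_mul) x z, ?_⟩
      exact (Hardy.map_apply Λ.toContinuousLinearMap _ z).symm
    · change (τ (V₁ x)).fst ∈ S
      rw [h₁]
      exact hf _ hx
    · change (τ (V₂ x)).fst ∈ S
      rw [h₂]
      exact hs _ hx
  rw [liftSpan, hm.minimal] at hle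
  refine eq_top_iff.mpr fun f _ => ?_
  have : (τ (τ.symm (inl (Hardy F) Q f))).fst ∈ S :=
    hle (Submodule.mem_top (x := τ.symm (inl (Hardy F) Q f)))
  rwa [LinearIsometryEquiv.apply_symm_apply] at this

end Converse

end AndoModel

end


/-! ### The Douglas model theorem -/

theorem theoremT
    {H : Type u} [NormedAddCommGroup H] [InnerProductSpace ℂ H] [CompleteSpace H]
    (T₁ T₂ : H →L[ℂ] H) (hT : AndoModel.IsCommContractivePair T₁ T₂) :
    -- there is exactly one canonical pair of commuting unitaries
    (∃! W : (AndoModel.QSpace (T₁ * T₂) hT.norm_mul →L[ℂ] AndoModel.QSpace (T₁ * T₂) hT.norm_mul) ×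
        (AndoModel.QSpace (T₁ * T₂) hT.norm_mul →L[ℂ] AndoModel.QSpace (T₁ * T₂) hT.norm_mul),
      AndoModel.IsCanonicalPair hT W.1 W.2) ∧
    ∀ W₁ W₂ : AndoModel.QSpace (T₁ * T₂) hT.norm_mul →L[ℂ] AndoModel.QSpace (T₁ * T₂) hT.norm_mul,
      AndoModel.IsCanonicalPair hT W₁ W₂ →
      -- every Douglas-minimal Type I tuple gives a minimal lift
      (∀ (F : Type v) [NormedAddCommGroup F] [InnerProductSpace ℂ F] [CompleteSpace F]
          (Λ : AndoModel.DefectSpace (ContinuousLinearMap.adjoint (T₁ * T₂)) →ₗᵢ[ℂ] F)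
          (P U : F →L[ℂ] F),
        AndoModel.IsTypeIAndoTuple T₁ T₂ Λ P U → AndoModel.IsDouglasMinimal Λ P U →
        AndoModel.IsMinimalAndoLift T₁ T₂ (AndoModel.douglasEmb hT Λ)
          (AndoModel.blockDiag (AndoModel.bclFst P U) W₁)
          (AndoModel.blockDiag (AndoModel.bclSnd P U) W₂)) ∧
      -- every minimal lift is unitarily equivalent to such a model lift
      (∀ (K : Type w) [NormedAddCommGroup K] [InnerProductSpace ℂ K] [CompleteSpace K]
          (E : H →L[ℂ] K) (V₁ V₂ : K →L[ℂ] K),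
        AndoModel.IsMinimalAndoLift T₁ T₂ E V₁ V₂ →
        ∃ (F : Type w) (_ : NormedAddCommGroup F) (_ : InnerProductSpace ℂ F) (_ : CompleteSpace F)
          (Λ : AndoModel.DefectSpace (ContinuousLinearMap.adjoint (T₁ * T₂)) →ₗᵢ[ℂ] F)
          (P U : F →L[ℂ] F),
          AndoModel.IsTypeIAndoTuple T₁ T₂ Λ P U ∧ AndoModel.IsDouglasMinimal Λ P U ∧
          AndoModel.LiftsEquivalent E V₁ V₂ (AndoModel.douglasEmb hT Λ)
            (AndoModel.blockDiag (AndoModel.bclFst P U) W₁)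
            (AndoModel.blockDiag (AndoModel.bclSnd P U) W₂)) := by
  refine ⟨AndoModel.existsUnique_isCanonicalPair hT, fun W₁ W₂ hW => ?_⟩
  have hcyc : AndoModel.IsCyclicMap (AndoModel.Qemb (T₁ * T₂) hT.norm_mul) (W₁ * W₂) := by
    rw [hW.mul_eq]
    exact AndoModel.isCyclicMap_WD _ _
  have hι := AndoModel.norm_Qemb (T₁ * T₂) hT.norm_mul
  refine ⟨?_, ?_⟩
  · intro F _ _ _ Λ P U ht hm
    -- `douglasEmb` unfolds to `column` of `obsEmb` and `Qemb`, so the lemmas about an abstract ι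
    -- apply with ι = `Qemb`.
    refine ⟨AndoModel.isAndoLift_model hT ht hι hW.unitary_fst hW.unitary_snd hW.comm
      hW.adjoint_fst hW.adjoint_snd, ?_⟩
    refine AndoModel.liftSpan_model_eq_top hT ht hm hW.comm hcyc fun h => ?_
    rw [hW.mul_eq]
    exact AndoModel.WD_Qemb_adjoint _ _ h
  · intro K _ _ _ E V₁ V₂ hm
    obtain ⟨Λ, hΛ⟩ := hm.toIsAndoLift.exists_defect_isometry
    have he := hm.liftsEquivalent hT hΛ hcyc hι hW.unitary_fst hW.unitary_snd hW.comm
      hW.adjoint_fst hW.adjoint_snd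
    -- The coefficient space is the wandering subspace of V₁V₂ inside K, hence in the universe of K.
    exact ⟨AndoModel.wandering (V₁ * V₂), inferInstance, inferInstance, inferInstance, Λ, _, _,
      hm.toIsAndoLift.isTypeIAndoTuple hΛ,
      AndoModel.isDouglasMinimal_of_liftsEquivalent hT hm he, he⟩
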